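/- Setting. Let $g>0$, $a\in\mathbb R$. For $N\ge 1$ let $d_N=\frac1N\bigl(1-\frac{\tilde a}{\sqrt N}\bigr)$ with $\tilde a=a\tilde g^2$, $\tilde g=(12/g)^{1/4}$. A current on a finite set $V$ is a function $\mathbf n$ from the unordered pairs of distinct points of $V$ to $\mathbb N=\{0,1,2,\dots\}$; its degree at $x$ is $\Delta\mathbf n(x)=\sum_{y\neq x}\mathbf n_{x,y}$, and its clusters are the connected components of the graph of the pairs on which $\mathbf n>0$. Tangling probabilities. Let $X=S\sqcup T$ be a finite set with $|S|,|T|$ even. A partition of $X$ is admissible if each of its classes contains an even number of points of $S$ and an even number of points of $T$. For $N\geq |X|$ (large enough that $d_N>0$) view $X$ as a subset of the vertices of the complete graph $K_N$. Give a pair $(\mathbf m_1,\mathbf m_2)$ of currents on $K_N$, such that the set of vertices of odd degree is $S$ for $\mathbf m_1$ and $T$ for $\mathbf m_2$, a probability proportional to $\prod_{e}\frac{d_N^{\mathbf m_1(e)}}{\mathbf m_1(e)!}\,\frac{d_N^{\mathbf m_2(e)}}{\mathbf m_2(e)!}$, and let $\rho_N^{S,T}$ be the law of the (admissible) partition of $X$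 induced by the clusters of $\mathbf m_1+\mathbf m_2$. A limiting tangling measure $\rho^{S,T}$ is a probability measure on the admissible partitions of $X$ that is the pointwise limit of $\rho^{S,T}_{N_k}$ along some strictly increasing sequence $(N_k)$. Blocks. Let $\Lambda$ be a finite set, $\mathfrak g\notin\Lambda$ a ghost vertex, $\Lambda_{\mathfrak g}=\Lambda\cup\{\mathfrak g\}$. Let $A,B\in\mathbb N^{\Lambda_{\mathfrak g}}$ have even sums and values at most $1$ at $\mathfrak g$, and let $\mathbf n_1,\mathbf n_2$ be currents on $\Lambda_{\mathfrak g}$ such that, for all $x\in\Lambda$, $\Delta\mathbf n_1(x)\equiv A_x$ and $\Delta\mathbf n_2(x)\equiv B_x$ modulo $2$. Put $\mathbf n=\mathbf n_1+\mathbf n_2$. For $z\in\Lambda$, the block $\mathcal B_z(\mathbf n_1,A)$ consists of $(\mathbf n_1)_{z,y}$ points for each $y\neq z$ and $A_z$ further points, $\mathcal B_z(\mathbf n_2,B)$ is defined likewise, and $\mathcal B_z(\mathbf n,A,B)$ is their disjoint union. Let $\rho^{\mathbf n_1,\mathbf n_2}_{z,A,B}$ be a limiting tangling measure $\rho^{S,T}$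 with $S=\mathcal B_z(\mathbf n_1,A)$, $T=\mathcal B_z(\mathbf n_2,B)$, and let $\rho^{\mathbf n_1}_{z,A}$ be a limiting tangling measure $\rho^{S,\emptyset}$ with $S=\mathcal B_z(\mathbf n_1,A)$; it lives on the partitions of $\mathcal B_z(\mathbf n_1,A)$ into sets of even size. Proposition. For every integer $M\ge1$ there is $\kappa=\kappa(M)>0$ (depending only on $M$, $g$, $a$) such that the following holds for all $\Lambda,A,B,\mathbf n_1,\mathbf n_2$ as above. 1. For every $z\in\Lambda$ with $\max(A_z,B_z,\Delta\mathbf n(z))\le M$, limiting tangling measures $\rho^{\mathbf n_1,\mathbf n_2}_{z,A,B}$ exist, and each of them satisfies $\rho^{\mathbf n_1,\mathbf n_2}_{z,A,B}(P)\ge\kappa$ for every admissible partition $P$ of $\mathcal B_z(\mathbf n,A,B)$. 2. For every $z\in\Lambda$ with $\max(A_z,\Delta\mathbf n_1(z))\le M$, limiting tangling measures $\rho^{\mathbf n_1}_{z,A}$ exist, and each of them satisfies $\rho^{\mathbf n_1}_{z,A}(P)\ge\kappa$ for every even partition $P$ of $\mathcal B_z(\mathbf n_1,A)$. In particular, under each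 of these measures the event that all the points of the block are tangled together (lie in one class of the partition) has probability at least $\kappa>0$. -/

import Mathlib

open Filter Topology

universe u

noncomputable section

namespace Tangled

/-! ## Currents -/

/-- A current on a vertex set `V`: a natural number on every unordered pair of distinct vertices. -/
abbrev Current (V : Type*) : Type _ := {e : Sym2 V // ¬ e.IsDiag} → ℕ

/-- The value of the current on the pair `{x, y}` (and `0` if `x = y`). -/
def Current.val {V : Type*} [DecidableEq V] (n : Current V) (x y : V) : ℕ :=
  if h : ¬ (s(x, y)).IsDiag then n ⟨s(x, y), h⟩ else 0

/-- The degree of the vertex `x` in the current `n`. -/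
def Current.degree {V : Type*} [Fintype V] [DecidableEq V] (n : Current V) (x : V) : ℕ :=
  ∑ y, n.val x y

/-- The vertices of odd degree. -/
def Current.sources {V : Type*} [Fintype V] [DecidableEq V] (n : Current V) : Finset V :=
  Finset.univ.filter fun x => Odd (n.degree x)

/-- The graph whose edges are the pairs on which the current is positive; its connected components
are the clusters of the current. -/
def Current.graph {V : Type*} (n : Current V) : SimpleGraph V :=
  SimpleGraph.fromEdgeSet {e | ∃ h : ¬ e.IsDiag, 0 < n ⟨e, h⟩}

/-- The random current weight of the Ising model on the complete graph with vertex set `V`, with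
coupling `d` on every edge. -/
def Current.weight {V : Type*} [Fintype V] [DecidableEq V] (d : ℝ) (n : Current V) : ℝ :=
  ∏ e, d ^ n e / (Nat.factorial (n e) : ℝ)

/-! ## Moments, blocks and admissible partitions

`Λ` is a finite set of vertices, and `Option Λ` is `Λ` together with the ghost vertex `none`.
Currents and moments without ghost are those which vanish at the ghost. -/

/-- Admissible moments: `A` is at most `1` at the ghost and has an even sum. -/
def IsMoment {Λ : Type*} [Fintype Λ] (A : Option Λ → ℕ) : Prop :=
  A none ≤ 1 ∧ Even (∑ x, A x)

/-- `∂n = ∂A`: away from the ghost, the degree of `n` and the moment `A` have the same parity. -/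
def SameSources {Λ : Type*} [Fintype Λ] [DecidableEq Λ]
    (n : Current (Option Λ)) (A : Option Λ → ℕ) : Prop :=
  ∀ x : Λ, Odd (n.degree (some x)) ↔ Odd (A (some x))

/-- The block of `z` in the current `n` with moment `A`: a point `zy(k)` for every `y` and every
`k < n(z, y)`, and a point `za(k)` for every `k < A z`. -/
abbrev Block {Λ : Type u} [DecidableEq Λ] (n : Current (Option Λ)) (A : Option Λ → ℕ) (z : Λ) :
    Type u :=
  (Σ y : Option Λ, Fin (n.val (some z) y)) ⊕ Fin (A (some z))

/-- The block of `z` in the double current `n₁ + n₂` with moments `A` and `B`: the disjoint union of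
the blocks of `(n₁, A)` and of `(n₂, B)`. -/
abbrev DoubleBlock {Λ : Type u} [DecidableEq Λ] (n₁ n₂ : Current (Option Λ))
    (A B : Option Λ → ℕ) (z : Λ) : Type u :=
  Block n₁ A z ⊕ Block n₂ B z

/-- Partitions of `X` (given as equivalence relations), each of whose classes contains an even
number of points of `S` and an even number of points of `T`. -/
def IsAdmissible {X : Type*} (S T : Finset X) (P : Setoid X) : Prop :=
  ∀ c ∈ P.classes, Even (c ∩ (S : Set X)).ncard ∧ Even (c ∩ (T : Set X)).ncard

/-- The admissible partitions of `X` with respect to the two sets `S` and `T`. For `S = univ` and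
`T = ∅` these are the even partitions of `X`. -/
abbrev AdmissiblePartition {X : Type*} (S T : Finset X) : Type _ :=
  {P : Setoid X // IsAdmissible S T P}

/-! ## Tangling measures

In this part the points of the block `X` are split into the sources `S` of a first current and the
sources `T` of a second current on the complete graph `K_N`. -/

/-- The coupling `d_N` of the block-spin Ising model on `K_N`:
`d_N = (1 - ã / √N) / N`, where `ã = a g̃²` and `g̃ = (12 / g)^(1/4)`. -/
def coupling (g a : ℝ) (N : ℕ) : ℝ :=
  1 / (N : ℝ) * (1 - a * ((12 / g) ^ (1 / 4 : ℝ)) ^ 2 / √(N : ℝ))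

/-- The vertex set of `K_N`, `N ≥ |X|`: the points of `X` and `N - |X|` further points. -/
abbrev BlockVertex (X : Type*) [Fintype X] (N : ℕ) : Type _ :=
  X ⊕ Fin (N - Fintype.card X)

/-- Pairs of currents on `K_N` whose source sets are `S` and `T`, respectively. -/
def sourcedPairs {X : Type*} [Fintype X] [DecidableEq X] (S T : Finset X) (N : ℕ) :
    Set (Current (BlockVertex X N) × Current (BlockVertex X N)) :=
  {p | p.1.sources = S.map Function.Embedding.inl ∧ p.2.sources = T.map Function.Embedding.inl}

/-- The partition of `X` induced by the clusters of a current on `K_N`. -/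
def clusterPartition {X : Type*} [Fintype X] {N : ℕ} (n : Current (BlockVertex X N)) : Setoid X :=
  Setoid.comap Sum.inl n.graph.reachableSetoid

/-- The total weight of a set of pairs of currents on `K_N`. -/
def pairMass {X : Type*} [Fintype X] [DecidableEq X] (g a : ℝ) (N : ℕ)
    (E : Set (Current (BlockVertex X N) × Current (BlockVertex X N))) : ℝ :=
  ∑' p : E, p.1.1.weight (coupling g a N) * p.1.2.weight (coupling g a N)

/-- The probability that the clusters of `m₁ + m₂` induce the partition `P` on the sources, for a
pair `(m₁, m₂)` of independent random currents on `K_N` with sources `S` and `T`. -/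
def tanglingProb {X : Type*} [Fintype X] [DecidableEq X] (g a : ℝ) (S T : Finset X) (N : ℕ)
    (P : Setoid X) : ℝ :=
  pairMass g a N {p ∈ sourcedPairs S T N | clusterPartition (p.1 + p.2) = P} /
    pairMass g a N (sourcedPairs S T N)

/-- `ρ` is the limit of the tangling probabilities on `K_N` along the increasing sequence of sizes
`N 0 < N 1 < N 2 < ...`. -/
def IsTanglingLimit {X : Type*} [Fintype X] [DecidableEq X] (g a : ℝ) (S T : Finset X)
    (N : ℕ → ℕ) (ρ : PMF (AdmissiblePartition S T)) : Prop :=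
  StrictMono N ∧
    ∀ P, Tendsto (fun k => tanglingProb g a S T (N k) P.1) atTop (𝓝 (ρ P).toReal)

section Blocks

variable {Λ : Type u} [Fintype Λ] [DecidableEq Λ]

/-- The points of the double block which belong to the block of `(n₁, A)`. -/
def firstPart (n₁ n₂ : Current (Option Λ)) (A B : Option Λ → ℕ) (z : Λ) :
    Finset (DoubleBlock n₁ n₂ A B z) :=
  Finset.univ.map Function.Embedding.inl

/-- The points of the double block which belong to the block of `(n₂, B)`. -/
def secondPart (n₁ n₂ : Current (Option Λ)) (A B : Option Λ → ℕ) (z : Λ) :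
    Finset (DoubleBlock n₁ n₂ A B z) :=
  Finset.univ.map Function.Embedding.inr

/-- The admissible partitions of the block of `z` in the double current `n₁ + n₂`. -/
abbrev DoubleTangling (n₁ n₂ : Current (Option Λ)) (A B : Option Λ → ℕ) (z : Λ) : Type u :=
  AdmissiblePartition (firstPart n₁ n₂ A B z) (secondPart n₁ n₂ A B z)

/-- The even partitions of the block of `z` in the current `n`. -/
abbrev SingleTangling (n : Current (Option Λ)) (A : Option Λ → ℕ) (z : Λ) : Type u :=
  AdmissiblePartition (Finset.univ : Finset (Block n A z)) ∅

/-- `ρ` is a tangling measure of the double current at `z`, obtained along the sizes `N k`. -/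
def IsDoubleTanglingMeasure (g a : ℝ) (n₁ n₂ : Current (Option Λ)) (A B : Option Λ → ℕ) (z : Λ)
    (N : ℕ → ℕ) (ρ : PMF (DoubleTangling n₁ n₂ A B z)) : Prop :=
  IsTanglingLimit g a (firstPart n₁ n₂ A B z) (secondPart n₁ n₂ A B z) N ρ

/-- `ρ` is a tangling measure of the single current at `z`, obtained along the sizes `N k`. It is
the double current measure in which the second current and its moment vanish, so that the second
random current on `K_N` has no sources. -/
def IsSingleTanglingMeasure (g a : ℝ) (n : Current (Option Λ)) (A : Option Λ → ℕ) (z : Λ)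
    (N : ℕ → ℕ) (ρ : PMF (SingleTangling n A z)) : Prop :=
  IsTanglingLimit g a (Finset.univ : Finset (Block n A z)) ∅ N ρ

end Blocks

end Tangled

end

/-!
The tangling probability of a partition `P` is the ratio of two masses of pairs of currents on `K_N`:
those with sources `S`, `T` whose clusters induce `P`, and all those with sources `S`, `T`. Write `z`
for the mass of the sourceless currents. Both masses are compared with `N ^ (-|X| / 4) * z ^ 2`:
`2 * k` sources cost a factor of order `(√N) ^ (- k)`.

*Upper bound.* By the random current expansion (`hasSum_current`), masses of currents are sums over
Curie-Weiss spins with weight `exp (d * M ^ 2 / 2)`, where `M` is the magnetization. Integrating out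
one spin and using `y * tanh y ≤ y ^ 2 - y ^ 4 / 12` gives a recursive inequality for the moments of
`M` (`moment_inequality`), and the quartic term makes `M / N ^ (3 / 4)` have bounded moments when
`d = (1 + O(1 / √N)) / N` (`exists_moment_le`). Since all correlations are nonnegative and symmetric,
this bounds the correlation of `2 * k` spins by `O((√N) ^ (- k))` (`exists_spinCurrentMass_le`). The
second moment also shows that removing `O(√N)` vertices changes `z` by a bounded factor only
(`exists_le_spinCurrentMass`).

*Lower bound.* Configurations that induce `P` are built by walks of length at most `√N` that start
from the sources. A source at `x` may be moved to a fresh vertex `y` by adding a pendant edge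
`{x, y}`; the choice of `y` compensates the weight `d` of the edge, so that every walk gains a factor
`√N` from the choice of its length (`geom_sum_le_of_step`). Two sources that form a class are joined
by one walk, at a cost `√N * d`. In a larger class, two sources `a`, `b` of the same current and a
third point `c` are brought to a common vertex by three walks, which replaces them by the single point
`c`, at a cost `(√N) ^ 3 * d ^ 2`. Both costs are of order `1 / √N`, and induction on the number of
sources leaves sourceless currents on all but `O(√N)` vertices (`le_mass_event`). Contributions of
different walks are disjoint events, since a walk can be recovered from the configuration: it stops at
a known vertex or at the first vertex that is not the end of a pendant edge.

The ratio is thus bounded below uniformly in large `N` (`exists_le_tanglingProb`); by the handshake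
lemma the tangling probabilities of the admissible partitions add up to one, and compactness gives
the limiting measures (`exists_tangling_bound`).
-/

namespace Tangled

open scoped ENNReal

/-! ### Pendant edges of currents -/

section Pendant

variable {V : Type*} [DecidableEq V]

theorem Current.val_comm (n : Current V) (x y : V) : n.val x y = n.val y x := by
  simp only [Current.val, Sym2.eq_swap (a := x) (b := y)]

@[simp] theorem Current.val_self (n : Current V) (x : V) : n.val x x = 0 := by
  simp [Current.val]

theorem Current.val_of_ne (n : Current V) {x y : V} (h : x ≠ y) :
    n.val x y = n ⟨s(x, y), by simpa using h⟩ := by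
  simp [Current.val, h]

theorem Current.val_add (n m : Current V) (x y : V) :
    (n + m).val x y = n.val x y + m.val x y := by
  unfold Current.val
  split_ifs <;> simp

theorem Current.graph_adj (n : Current V) (x y : V) : n.graph.Adj x y ↔ 0 < n.val x y := by
  by_cases h : x = y
  · subst h; simp
  · simp [Current.graph, h, Current.val_of_ne]

/-- The current of the single edge `{a, y}`. -/
def edgeCurrent (a y : V) : Current V := fun e => if e.1 = s(a, y) then 1 else 0

theorem edgeCurrent_val {a y : V} (h : a ≠ y) (u w : V) :
    (edgeCurrent a y).val u w = if (u = a ∧ w = y) ∨ (u = y ∧ w = a) then 1 else 0 := by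
  by_cases huw : u = w
  · subst huw
    have : ¬ ((u = a ∧ u = y) ∨ (u = y ∧ u = a)) := by grind
    simp [this]
  · rw [Current.val_of_ne _ huw]
    simp [edgeCurrent]

/-- The current vanishes on all the pairs that are not contained in `R`. -/
def Current.SupportedOn (R : Finset V) (n : Current V) : Prop :=
  ∀ x y, 0 < n.val x y → x ∈ R

theorem Current.SupportedOn.val_eq_zero {R : Finset V} {n : Current V} (h : n.SupportedOn R)
    {x : V} (hx : x ∉ R) (y : V) : n.val x y = 0 := by
  by_contra hne
  exact hx (h x y (Nat.pos_of_ne_zero hne))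

/-! ### Configurations of two layers -/

/-- A pair of currents, indexed by `Bool` so that the two layers can be treated uniformly. -/
abbrev Config (V : Type*) : Type _ := Bool → Current V

/-- The sum of the two layers. -/
def Config.total (m : Config V) : Current V := m false + m true

/-- The configuration `m` with the edge `{a, y}` added to the layer `i`. -/
def Config.attach (m : Config V) (i : Bool) (a y : V) : Config V :=
  Function.update m i (m i + edgeCurrent a y)

theorem Config.total_attach (m : Config V) (i : Bool) (a y : V) :
    (m.attach i a y).total = m.total + edgeCurrent a y := by
  cases i <;> simp [Config.total, Config.attach, add_right_comm, add_assoc]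

theorem Config.total_val_attach (m : Config V) (i : Bool) {a y : V} (h : a ≠ y) (u w : V) :
    (m.attach i a y).total.val u w =
      m.total.val u w + if (u = a ∧ w = y) ∨ (u = y ∧ w = a) then 1 else 0 := by
  rw [Config.total_attach, Current.val_add, edgeCurrent_val h]

/-- Both layers vanish on all the pairs that are not contained in `R`. -/
def Config.SupportedOn (R : Finset V) (m : Config V) : Prop := ∀ i, (m i).SupportedOn R

theorem Config.SupportedOn.total {R : Finset V} {m : Config V} (h : m.SupportedOn R) :
    m.total.SupportedOn R := by
  intro x y hxy
  rw [Config.total, Current.val_add] at hxy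
  rcases Nat.eq_zero_or_pos ((m false).val x y) with h0 | h0
  · exact h true x y (by omega)
  · exact h false x y h0

theorem Config.SupportedOn.mono {R R' : Finset V} (hR : R ⊆ R') {m : Config V}
    (h : m.SupportedOn R) : m.SupportedOn R' := fun i x y hxy => hR (h i x y hxy)

theorem Config.SupportedOn.attach {R : Finset V} {m : Config V} (h : m.SupportedOn R) (i : Bool)
    {a y : V} (hay : a ≠ y) (ha : a ∈ R) (hy : y ∈ R) : (m.attach i a y).SupportedOn R := by
  intro j u w huw
  by_cases hj : j = i
  · subst hj
    simp only [Config.attach, Function.update_self, Current.val_add, edgeCurrent_val hay] at huw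
    split_ifs at huw with h1
    · rcases h1 with ⟨rfl, -⟩ | ⟨rfl, -⟩ <;> assumption
    · exact h j u w huw
  · simp only [Config.attach, ne_eq, hj, not_false_eq_true, Function.update_of_ne] at huw
    exact h j u w huw

/-- The endpoint of a pendant edge can be read off from the configuration. -/
theorem Config.total_val_attach_pendant {R : Finset V} {m : Config V} (h : m.SupportedOn R)
    (i : Bool) {a y : V} (ha : a ∉ R) (hay : a ≠ y) (w : V) :
    (m.attach i a y).total.val a w = if w = y then 1 else 0 := by
  rw [Config.total_val_attach _ _ hay, h.total.val_eq_zero ha]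
  simp [hay]

theorem Config.attach_injective (i : Bool) (a y : V) :
    Function.Injective fun m : Config V => m.attach i a y := by
  intro m m' h
  funext j
  have := congrFun h j
  by_cases hj : j = i
  · subst hj; simpa [Config.attach] using this
  · simpa [Config.attach, hj] using this

/-- Adding a pendant edge `{a, y}` amounts, for the connectivity relation, to identifying `a`
with `y`. -/
theorem Config.reachable_attach {R : Finset V} {m : Config V} (h : m.SupportedOn R)
    (i : Bool) {a y : V} (ha : a ∉ R) (hay : a ≠ y) (u w : V) :
    (m.attach i a y).total.graph.Reachable u w ↔
      m.total.graph.Reachable (if u = a then y else u) (if w = a then y else w) := by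
  have hle : m.total.graph ≤ (m.attach i a y).total.graph := by
    intro u w huw
    rw [Current.graph_adj] at huw ⊢
    rw [Config.total_val_attach _ _ hay]
    omega
  have hedge : (m.attach i a y).total.graph.Adj a y := by
    rw [Current.graph_adj, Config.total_val_attach _ _ hay]
    simp
  have hto : ∀ u : V, (m.attach i a y).total.graph.Reachable u (if u = a then y else u) := by
    intro u
    split_ifs with hu
    · subst hu; exact hedge.reachable
    · exact SimpleGraph.Reachable.refl _
  constructor
  · rintro ⟨p⟩
    induction p with
    | nil => exact SimpleGraph.Reachable.refl _
    | @cons u v w huv p ih =>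
      refine SimpleGraph.Reachable.trans ?_ ih
      rw [Current.graph_adj, Config.total_val_attach _ _ hay] at huv
      by_cases hcase : (u = a ∧ v = y) ∨ (u = y ∧ v = a)
      · rcases hcase with ⟨rfl, rfl⟩ | ⟨rfl, rfl⟩
        · simp
        · simp
      · rw [if_neg hcase, add_zero] at huv
        have hu : u ≠ a := fun hu => ha (hu ▸ h.total u v huv)
        have hv : v ≠ a := fun hv => ha (hv ▸ h.total v u (by rwa [Current.val_comm]))
        rw [if_neg hu, if_neg hv]
        exact ((Current.graph_adj _ _ _).2 huv).reachable
  · intro hr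
    exact ((hto u).trans (hr.mono hle)).trans (hto w).symm

variable [Fintype V]

theorem Current.degree_add (n m : Current V) (x : V) :
    (n + m).degree x = n.degree x + m.degree x := by
  simp [Current.degree, Current.val_add, Finset.sum_add_distrib]

theorem edgeCurrent_degree {a y : V} (h : a ≠ y) (x : V) :
    (edgeCurrent a y).degree x = if x = a ∨ x = y then 1 else 0 := by
  unfold Current.degree
  simp only [edgeCurrent_val h]
  by_cases hxa : x = a
  · subst hxa; simp [h]
  · by_cases hxy : x = y
    · subst hxy; simp [hxa]
    · simp [hxa, hxy]

theorem weight_add_edgeCurrent (d : ℝ) (n : Current V) {a y : V} (h : a ≠ y)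
    (h0 : n.val a y = 0) : (n + edgeCurrent a y).weight d = d * n.weight d := by
  rw [Current.val_of_ne _ h] at h0
  unfold Current.weight
  rw [← Finset.mul_prod_erase _ _ (Finset.mem_univ (⟨s(a, y), by simpa using h⟩ :
    {e : Sym2 V // ¬ e.IsDiag}))]
  rw [← Finset.mul_prod_erase (a := (⟨s(a, y), by simpa using h⟩ :
    {e : Sym2 V // ¬ e.IsDiag})) (s := Finset.univ)
    (f := fun e => d ^ n e / (Nat.factorial (n e) : ℝ)) (Finset.mem_univ _)]
  rw [← mul_assoc]
  congr 1
  · simp [h0, edgeCurrent]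
  · refine Finset.prod_congr rfl fun e he => ?_
    have : e.1 ≠ s(a, y) := fun h' => (Finset.mem_erase.1 he).1 (Subtype.ext h')
    simp [edgeCurrent, this]

theorem Current.SupportedOn.degree_eq_zero {R : Finset V} {n : Current V} (h : n.SupportedOn R)
    {x : V} (hx : x ∉ R) : n.degree x = 0 := by
  simp [Current.degree, h.val_eq_zero hx]

theorem Config.degree_attach (m : Config V) (i j : Bool) {a y : V} (h : a ≠ y) (x : V) :
    (m.attach i a y j).degree x =
      (m j).degree x + if j = i ∧ (x = a ∨ x = y) then 1 else 0 := by
  by_cases hj : j = i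
  · subst hj
    simp [Config.attach, Current.degree_add, edgeCurrent_degree h]
  · simp [Config.attach, hj]

theorem Config.total_degree_attach (m : Config V) (i : Bool) {a y : V} (h : a ≠ y) (x : V) :
    (m.attach i a y).total.degree x =
      m.total.degree x + if x = a ∨ x = y then 1 else 0 := by
  rw [Config.total_attach, Current.degree_add, edgeCurrent_degree h]

end Pendant

/-! ### Masses of events -/

section Mass

variable {V : Type*} [Fintype V] [DecidableEq V]

/-- The weight of a configuration: the product of the random current weights of its layers. -/
noncomputable def Config.weight (d : ℝ) (m : Config V) : ℝ≥0∞ :=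
  ∏ i, ENNReal.ofReal ((m i).weight d)

/-- The total weight of a set of configurations. -/
noncomputable def mass (d : ℝ) (E : Set (Config V)) : ℝ≥0∞ := ∑' m : E, m.1.weight d

theorem mass_mono (d : ℝ) {E F : Set (Config V)} (h : E ⊆ F) : mass d E ≤ mass d F :=
  ENNReal.tsum_mono_subtype _ h

theorem Config.weight_attach {d : ℝ} (hd : 0 ≤ d) {R : Finset V} {m : Config V}
    (h : m.SupportedOn R) (i : Bool) {a y : V} (ha : a ∉ R) (hay : a ≠ y) :
    (m.attach i a y).weight d = ENNReal.ofReal d * m.weight d := by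
  have key : ((m i + edgeCurrent a y)).weight d = d * (m i).weight d :=
    weight_add_edgeCurrent d _ hay ((h i).val_eq_zero ha y)
  cases i <;>
  simp [Config.weight, Config.attach, key, ENNReal.ofReal_mul hd, mul_assoc, mul_left_comm]

theorem mass_add_le (d : ℝ) {E F T : Set (Config V)} (hE : E ⊆ T) (hF : F ⊆ T)
    (hdisj : Disjoint E F) : mass d E + mass d F ≤ mass d T := by
  unfold mass
  rw [← ENNReal.summable.tsum_union_disjoint hdisj ENNReal.summable]
  exact ENNReal.tsum_mono_subtype _ (Set.union_subset hE hF)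

/-- The configurations with a pendant edge `{a, y}`, for different `y`, are disjoint: their masses
add up to a lower bound for the mass of an event. -/
theorem sum_mass_le_of_attach {d : ℝ} (hd : 0 ≤ d) {R Y : Finset V} {a : V} (ha : a ∉ R)
    (haY : a ∉ Y) (i : Bool) (F : V → Set (Config V)) (T : Set (Config V))
    (hR : ∀ y ∈ Y, ∀ m ∈ F y, m.SupportedOn R)
    (hT : ∀ y ∈ Y, ∀ m ∈ F y, m.attach i a y ∈ T) :
    ∑ y ∈ Y, ENNReal.ofReal d * mass d (F y) ≤ mass d T := by
  let f : (Σ y : Y, F y) → T := fun p => ⟨p.2.1.attach i a p.1.1, hT _ p.1.2 _ p.2.2⟩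
  have hne : ∀ y : Y, a ≠ y.1 := fun y h => haY (h ▸ y.2)
  have hf : Function.Injective f := by
    rintro ⟨y, m⟩ ⟨y', m'⟩ h
    have h' : m.1.attach i a y.1 = m'.1.attach i a y'.1 := congrArg Subtype.val h
    have hy : y = y' := by
      have h1 := Config.total_val_attach_pendant (hR _ y.2 _ m.2) i ha (hne y) y.1
      have h2 := Config.total_val_attach_pendant (hR _ y'.2 _ m'.2) i ha (hne y') y.1
      rw [h', h2] at h1
      apply Subtype.ext
      by_contra hcon
      simp [hcon] at h1
    subst hy
    have : m = m' := Subtype.ext (Config.attach_injective i a y.1 h')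
    rw [this]
  calc ∑ y ∈ Y, ENNReal.ofReal d * mass d (F y)
      = ∑' y : Y, ENNReal.ofReal d * mass d (F y) := by
        rw [tsum_fintype, Finset.univ_eq_attach,
          Finset.sum_attach Y fun y => ENNReal.ofReal d * mass d (F y)]
    _ = ∑' p : (Σ y : Y, F y), (f p).1.weight d := by
        rw [ENNReal.tsum_sigma']
        refine tsum_congr fun y => ?_
        rw [mass, ← ENNReal.tsum_mul_left]
        refine tsum_congr fun m => ?_
        exact (Config.weight_attach hd (hR _ y.2 _ m.2) i ha (hne y)).symm
    _ ≤ mass d T := ENNReal.tsum_comp_le_tsum_of_injective hf fun m : T => m.1.weight d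

/-- First step decomposition: the event `T` contains the configurations with a pendant edge at `a`
whose remainder lies in `F y`, and a set `E` of configurations without such a pendant edge. -/
theorem mass_add_sum_le_of_attach {d : ℝ} (hd : 0 ≤ d) {R Y : Finset V} {a : V} (ha : a ∉ R)
    (haY : a ∉ Y) (i : Bool) (F : V → Set (Config V)) (E T : Set (Config V))
    (hR : ∀ y ∈ Y, ∀ m ∈ F y, m.SupportedOn R)
    (hT : ∀ y ∈ Y, ∀ m ∈ F y, m.attach i a y ∈ T)
    (hE : E ⊆ T) (hdisj : ∀ y ∈ Y, ∀ m ∈ F y, m.attach i a y ∉ E) :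
    mass d E + ∑ y ∈ Y, ENNReal.ofReal d * mass d (F y) ≤ mass d T := by
  refine le_trans (add_le_add le_rfl
    (sum_mass_le_of_attach hd ha haY i F (T \ E) hR fun y hy m hm => ⟨hT y hy m hm,
      hdisj y hy m hm⟩)) (mass_add_le d hE Set.sdiff_subset Set.disjoint_sdiff_right)

/-- The mass of an event is the sum of the masses of the parts cut out by the values of a
function. -/
theorem sum_mass_fiber {β : Type*} [Fintype β] (d : ℝ) (T : Set (Config V))
    (f : ∀ m, m ∈ T → β) :
    ∑ b, mass d {m | ∃ h : m ∈ T, f m h = b} = mass d T := by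
  classical
  simp only [mass, tsum_subtype _ fun m : Config V => m.weight d]
  rw [← Summable.tsum_finsetSum fun _ _ => ENNReal.summable]
  refine tsum_congr fun m => ?_
  by_cases hm : m ∈ T
  · rw [Finset.sum_eq_single (f m hm)]
    · simp [Set.indicator, hm]
    · intro b _ hb
      simp [Set.indicator, hm, hb.symm]
    · simp
  · simp [Set.indicator, hm]

end Mass

/-! ### Iterated steps -/

section Walks

variable {V ι : Type*} [DecidableEq V] {A : Finset ι}

/-- The positions `pos` of the points of `A` are distinct vertices of the region `R`. -/
def Placed (R : Finset V) (A : Finset ι) (pos : ι → V) : Prop :=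
  (∀ u ∈ A, pos u ∈ R) ∧ Set.InjOn pos A

variable [DecidableEq ι]

theorem Placed.update {R : Finset V} {pos : ι → V} (h : Placed R A pos) {x : ι} (hx : x ∈ A)
    {y : V} (hyR : y ∈ R) (hyA : ∀ u ∈ A, pos u ≠ y) :
    Placed (R.erase (pos x)) A (Function.update pos x y) := by
  refine ⟨fun u hu => ?_, fun u hu w hw huw => ?_⟩
  · by_cases hux : u = x
    · subst hux
      simp only [Function.update_self, Finset.mem_erase]
      exact ⟨fun h => hyA u hu h.symm, hyR⟩
    · rw [Function.update_of_ne hux, Finset.mem_erase]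
      exact ⟨fun h' => hux (h.2 hu hx h'), h.1 u hu⟩
  · by_cases hux : u = x <;> by_cases hwx : w = x
    · rw [hux, hwx]
    · subst hux
      rw [Function.update_self, Function.update_of_ne hwx] at huw
      exact absurd huw.symm (hyA w hw)
    · subst hwx
      rw [Function.update_self, Function.update_of_ne hux] at huw
      exact absurd huw (hyA u hu)
    · rw [Function.update_of_ne hux, Function.update_of_ne hwx] at huw
      exact h.2 hu hw huw

theorem Placed.erase {R : Finset V} {pos : ι → V} (h : Placed R A pos) {x : ι} (hx : x ∈ A) :
    Placed (R.erase (pos x)) (A.erase x) pos := by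
  refine ⟨fun u hu => ?_, h.2.mono (by simp)⟩
  rw [Finset.mem_erase] at hu ⊢
  exact ⟨fun h' => hu.1 (h.2 hu.2 hx h'), h.1 u hu.2⟩

/-- If `f` gains at least `e` at every step of a walk of the marked point `x` through fresh
vertices, and a step multiplies the mass by at least `β`, then `t` steps gain at least
`e * (1 + β + ⋯ + β ^ (t - 1))`. -/
theorem geom_sum_le_of_step (f : Finset V → (ι → V) → ℝ≥0∞) {x : ι} (hx : x ∈ A) (F : Finset V)
    (D β e : ℝ≥0∞) (r : ℕ)
    (hβ : β ≤ D * ((r - (A.card + F.card) : ℕ) : ℝ≥0∞))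
    (hstep : ∀ (R : Finset V) (pos : ι → V), Placed R A pos → F ⊆ R → (∀ u ∈ A, pos u ∉ F) → r ≤ R.card →
      e + ∑ y ∈ (R \ A.image pos) \ F, D * f (R.erase (pos x)) (Function.update pos x y)
        ≤ f R pos) :
    ∀ (t : ℕ) (R : Finset V) (pos : ι → V), Placed R A pos → F ⊆ R → (∀ u ∈ A, pos u ∉ F) → r + t ≤ R.card →
      e * ∑ j ∈ Finset.range (t + 1), β ^ j ≤ f R pos := by
  intro t
  induction t with
  | zero =>
    intro R pos hpos h3 h4 h5
    refine le_trans ?_ (hstep R pos hpos h3 h4 h5)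
    simp
  | succ t ih =>
    intro R pos hpos h3 h4 h5
    refine le_trans ?_ (hstep R pos hpos h3 h4 (by omega))
    rw [geom_sum_succ, mul_add, mul_one, add_comm]
    refine add_le_add le_rfl ?_
    have hlow : ∀ y ∈ (R \ A.image pos) \ F, D * (e * ∑ j ∈ Finset.range (t + 1), β ^ j) ≤
        D * f (R.erase (pos x)) (Function.update pos x y) := by
      intro y hy
      simp only [Finset.mem_sdiff, Finset.mem_image, not_exists, not_and] at hy
      obtain ⟨⟨hyR, hyA⟩, hyF⟩ := hy
      refine mul_le_mul_right (ih _ _ (hpos.update hx hyR hyA) ?_ ?_ ?_) _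
      · intro v hv
        rw [Finset.mem_erase]
        exact ⟨fun h => h4 x hx (h ▸ hv), h3 hv⟩
      · intro u hu
        by_cases hux : u = x
        · subst hux; simpa using hyF
        · rw [Function.update_of_ne hux]; exact h4 u hu
      · rw [Finset.card_erase_of_mem (hpos.1 x hx)]; omega
    refine le_trans ?_ (Finset.sum_le_sum hlow)
    rw [Finset.sum_const, nsmul_eq_mul]
    have hcard : r - (A.card + F.card) ≤ ((R \ A.image pos) \ F).card := by
      have a1 := Finset.le_card_sdiff F (R \ A.image pos)
      have a2 := Finset.le_card_sdiff (A.image pos) R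
      have a3 : (A.image pos).card ≤ A.card := Finset.card_image_le
      omega
    generalize ∑ j ∈ Finset.range (t + 1), β ^ j = S
    calc e * (β * S) = β * (e * S) := by ring
      _ ≤ (D * ((r - (A.card + F.card) : ℕ) : ℝ≥0∞)) * (e * S) := by gcongr
      _ ≤ (D * ((((R \ A.image pos) \ F).card : ℕ) : ℝ≥0∞)) * (e * S) := by gcongr
      _ = _ := by ring

end Walks

/-! ### Events described by marked points, and their first step decompositions -/

section Events

variable {V ι : Type*} [Fintype V] [DecidableEq V] [DecidableEq ι]

/-- The configurations that live on the region `R`, in which the odd vertices of the layer `i` are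
the positions of the points of `A` of colour `i`, and whose clusters induce the partition `P` on the
points of `A`. -/
def event (col : ι → Bool) (P : Setoid ι) (R : Finset V) (A : Finset ι) (pos : ι → V) :
    Set (Config V) :=
  {m | m.SupportedOn R ∧
    (∀ i z, Odd ((m i).degree z) ↔ ∃ u ∈ A, col u = i ∧ pos u = z) ∧
    ∀ u ∈ A, ∀ w ∈ A, m.total.graph.Reachable (pos u) (pos w) ↔ P u w}

/-- The configurations of `event` in which the cluster of the point `c` contains the vertex `v`. -/
def linkedEvent (col : ι → Bool) (P : Setoid ι) (R : Finset V) (A : Finset ι) (c : ι) (v : V)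
    (pos : ι → V) : Set (Config V) :=
  {m ∈ event col P R A pos | m.total.graph.Reachable (pos c) v}

/-- The configurations of `event` in which the point `a` is not the endpoint of a pendant edge. -/
def branchEvent (col : ι → Bool) (P : Setoid ι) (R : Finset V) (A : Finset ι) (a : ι)
    (pos : ι → V) : Set (Config V) :=
  {m ∈ event col P R A pos | m.total.degree (pos a) ≠ 1}

variable {col : ι → Bool} {P : Setoid ι} {R : Finset V} {A : Finset ι} {pos : ι → V}

/-- Moving the point `x` from `y` to `pos x` along a new pendant edge. -/
theorem attach_mem_event_of_move {x : ι} (hx : x ∈ A) (hinj : Set.InjOn pos A)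
    (hxR : pos x ∈ R) {y : V} (hy : y ∈ R) (hyA : ∀ u ∈ A, pos u ≠ y) {m : Config V}
    (hm : m ∈ event col P (R.erase (pos x)) A (Function.update pos x y)) :
    m.attach (col x) (pos x) y ∈ event col P R A pos := by
  obtain ⟨h1, h2, h3⟩ := hm
  have hxy := hyA x hx
  have hnot : pos x ∉ R.erase (pos x) := by simp
  refine ⟨(h1.mono (Finset.erase_subset _ _)).attach _ hxy hxR hy, ?_, ?_⟩
  · intro j z
    rw [Config.degree_attach _ _ _ hxy]
    by_cases hz : z = pos x
    · subst hz
      rw [(h1 j).degree_eq_zero hnot]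
      by_cases hj : j = col x
      · subst hj
        simp only [true_and, true_or, if_true, zero_add, odd_one, true_iff]
        exact ⟨x, hx, rfl, rfl⟩
      · simp only [hj, false_and, if_false, add_zero, Nat.not_odd_zero, false_iff]
        rintro ⟨u, hu, rfl, hux⟩
        exact hj (by rw [hinj hu hx hux])
    · by_cases hzy : z = y
      · subst hzy
        have hr : ¬ ∃ u ∈ A, col u = j ∧ pos u = z := by
          rintro ⟨u, hu, -, h⟩; exact hyA u hu h
        simp only [hr, iff_false]
        by_cases hj : j = col x
        · subst hj
          have : Odd ((m (col x)).degree z) := (h2 _ _).2 ⟨x, hx, rfl, by simp⟩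
          simp only [or_true, and_true, if_true]
          grind
        · simp only [hj, false_and, if_false, add_zero, h2]
          rintro ⟨u, hu, hc, hp⟩
          by_cases hux : u = x
          · subst hux; exact hj hc.symm
          · rw [Function.update_of_ne hux] at hp; exact hyA u hu hp
      · simp only [hz, hzy, or_self, and_false, if_false, add_zero, h2]
        constructor
        · rintro ⟨u, hu, hc, hp⟩
          by_cases hux : u = x
          · subst hux; rw [Function.update_self] at hp; exact absurd hp.symm hzy
          · rw [Function.update_of_ne hux] at hp; exact ⟨u, hu, hc, hp⟩
        · rintro ⟨u, hu, hc, hp⟩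
          refine ⟨u, hu, hc, ?_⟩
          have hux : u ≠ x := by rintro rfl; exact hz hp.symm
          rwa [Function.update_of_ne hux]
  · have hupd : ∀ u ∈ A, (if pos u = pos x then y else pos u) = Function.update pos x y u := by
      intro u hu
      by_cases hux : u = x
      · subst hux; simp
      · rw [Function.update_of_ne hux, if_neg fun h => hux (hinj hu hx h)]
    intro u hu w hw
    rw [Config.reachable_attach h1 _ hnot hxy, hupd u hu, hupd w hw]
    exact h3 u hu w hw

/-- Moving the point `c`, from a vertex that is already connected to `v`. -/
theorem attach_mem_linkedEvent_of_move {c : ι} (hc : c ∈ A) (hinj : Set.InjOn pos A)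
    (hcR : pos c ∈ R) {y v : V} (hv : v ≠ pos c) (hy : y ∈ R) (hyA : ∀ u ∈ A, pos u ≠ y)
    {m : Config V} (hm : m ∈ event col P (R.erase (pos c)) A (Function.update pos c y))
    (hyv : m.total.graph.Reachable y v) :
    m.attach (col c) (pos c) y ∈ linkedEvent col P R A c v pos := by
  refine ⟨attach_mem_event_of_move hc hinj hcR hy hyA hm, ?_⟩
  rw [Config.reachable_attach hm.1 _ (by simp) (hyA c hc)]
  simpa [hv] using hyv

/-- Moving the point `b` does not affect the degree at another point `a`. -/
theorem attach_mem_branchEvent_of_move {a b : ι} (ha : a ∈ A) (hb : b ∈ A) (hab : a ≠ b)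
    (hinj : Set.InjOn pos A) (hbR : pos b ∈ R) {y : V} (hy : y ∈ R) (hyA : ∀ u ∈ A, pos u ≠ y)
    {m : Config V}
    (hm : m ∈ branchEvent col P (R.erase (pos b)) A a (Function.update pos b y)) :
    m.attach (col b) (pos b) y ∈ branchEvent col P R A a pos := by
  refine ⟨attach_mem_event_of_move hb hinj hbR hy hyA hm.1, ?_⟩
  have h := hm.2
  rw [Function.update_of_ne hab] at h
  have h1 : pos a ≠ pos b := fun h => hab (hinj ha hb h)
  rw [Config.total_degree_attach _ _ (hyA b hb)]
  simpa [h1, hyA a ha] using h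

/-- Joining the two points of a class of the partition by a single edge. -/
theorem attach_mem_event_of_pair {a b : ι} (ha : a ∈ A) (hb : b ∈ A) (hab : a ≠ b)
    (hcol : col a = col b) (hP : P a b) (hclass : ∀ u ∈ A, P a u → u = a ∨ u = b)
    (hinj : Set.InjOn pos A) (haR : pos a ∈ R) (hbR : pos b ∈ R) {m : Config V}
    (hm : m ∈ event col P ((R.erase (pos a)).erase (pos b)) ((A.erase a).erase b) pos) :
    m.attach (col a) (pos a) (pos b) ∈ event col P R A pos := by
  obtain ⟨h1, h2, h3⟩ := hm
  have hpab : pos a ≠ pos b := fun h => hab (hinj ha hb h)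
  have hna : pos a ∉ (R.erase (pos a)).erase (pos b) := by simp
  have hnb : pos b ∉ (R.erase (pos a)).erase (pos b) := by simp
  have hsub : (R.erase (pos a)).erase (pos b) ⊆ R :=
    (Finset.erase_subset _ _).trans (Finset.erase_subset _ _)
  refine ⟨(h1.mono hsub).attach _ hpab haR hbR, ?_, ?_⟩
  · intro j z
    rw [Config.degree_attach _ _ _ hpab]
    by_cases hz : z = pos a ∨ z = pos b
    · have h0 : (m j).degree z = 0 := by
        rcases hz with rfl | rfl
        · exact (h1 j).degree_eq_zero hna
        · exact (h1 j).degree_eq_zero hnb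
      simp only [h0, hz, and_true, zero_add]
      by_cases hj : j = col a
      · simp only [hj, if_true, odd_one, true_iff]
        rcases hz with rfl | rfl
        · exact ⟨a, ha, rfl, rfl⟩
        · exact ⟨b, hb, hcol.symm, rfl⟩
      · simp only [hj, if_false, Nat.not_odd_zero, false_iff]
        rintro ⟨u, hu, rfl, hux⟩
        rcases hz with rfl | rfl
        · exact hj (by rw [hinj hu ha hux])
        · exact hj (by rw [hinj hu hb hux, hcol])
    · simp only [hz, and_false, if_false, add_zero, h2]
      push Not at hz
      constructor
      · rintro ⟨u, hu, hc, hp⟩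
        exact ⟨u, Finset.mem_of_mem_erase (Finset.mem_of_mem_erase hu), hc, hp⟩
      · rintro ⟨u, hu, hc, hp⟩
        refine ⟨u, ?_, hc, hp⟩
        simp only [Finset.mem_erase]
        refine ⟨?_, ?_, hu⟩
        · rintro rfl; exact hz.2 hp.symm
        · rintro rfl; exact hz.1 hp.symm
  · -- `b` is an isolated vertex of the graph of `m`
    have hiso : ∀ z, m.total.graph.Reachable (pos b) z → z = pos b := by
      rintro z ⟨p⟩
      cases p with
      | nil => rfl
      | cons h p =>
        rw [Current.graph_adj, h1.total.val_eq_zero hnb] at h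
        omega
    have hcl : ∀ u ∈ A, u ≠ a → u ≠ b → ¬ P a u := by
      intro u hu h h' hPu
      rcases hclass u hu hPu with rfl | rfl
      · exact h rfl
      · exact h' rfl
    intro u hu w hw
    rw [Config.reachable_attach h1 _ hna hpab]
    have hpos : ∀ u ∈ A, u ≠ a → pos u ≠ pos a := fun u hu h h' => h (hinj hu ha h')
    by_cases hu' : u = a ∨ u = b
    · have e1 : (if pos u = pos a then pos b else pos u) = pos b := by
        rcases hu' with rfl | rfl
        · simp
        · rw [if_neg hpab.symm]
      have e2 : P u a := by
        rcases hu' with rfl | rfl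
        · exact P.refl' u
        · exact P.symm' hP
      rw [e1]
      by_cases hw' : w = a ∨ w = b
      · have e3 : (if pos w = pos a then pos b else pos w) = pos b := by
          rcases hw' with rfl | rfl
          · simp
          · rw [if_neg hpab.symm]
        have e4 : P a w := by
          rcases hw' with rfl | rfl
          · exact P.refl' w
          · exact hP
        rw [e3]
        exact ⟨fun _ => P.trans' e2 e4, fun _ => SimpleGraph.Reachable.refl _⟩
      · push Not at hw'
        rw [if_neg (hpos w hw hw'.1)]
        constructor
        · intro h
          exact absurd (hinj hw hb (hiso _ h)) hw'.2
        · intro h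
          exact absurd (P.trans' (P.symm' e2) h) (hcl w hw hw'.1 hw'.2)
    · push Not at hu'
      rw [if_neg (hpos u hu hu'.1)]
      by_cases hw' : w = a ∨ w = b
      · have e3 : (if pos w = pos a then pos b else pos w) = pos b := by
          rcases hw' with rfl | rfl
          · simp
          · rw [if_neg hpab.symm]
        have e4 : P a w := by
          rcases hw' with rfl | rfl
          · exact P.refl' w
          · exact hP
        rw [e3]
        constructor
        · intro h
          exact absurd (hinj hu hb (hiso _ h.symm)) hu'.2
        · intro h
          exact absurd (P.trans' e4 (P.symm' h)) (hcl u hu hu'.1 hu'.2)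
      · push Not at hw'
        rw [if_neg (hpos w hw hw'.1)]
        exact h3 u (by simp [hu, hu'.1, hu'.2]) w (by simp [hw, hw'.1, hw'.2])

/-- Attaching the point `b` to the point `a`, which lies in the cluster of a third point `c`. -/
theorem attach_mem_branchEvent_of_hit {a b c : ι} (ha : a ∈ A) (hb : b ∈ A) (hc : c ∈ A)
    (hab : a ≠ b) (hac : a ≠ c) (hbc : b ≠ c) (hcol : col a = col b) (hPb : P a b) (hPc : P a c)
    (hinj : Set.InjOn pos A) (haR : pos a ∈ R) (hbR : pos b ∈ R) {m : Config V}
    (hm : m ∈ linkedEvent col P (R.erase (pos b)) ((A.erase a).erase b) c (pos a) pos) :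
    m.attach (col b) (pos b) (pos a) ∈ branchEvent col P R A a pos := by
  obtain ⟨⟨h1, h2, h3⟩, h4⟩ := hm
  have hpab : pos b ≠ pos a := fun h => hab (hinj ha hb h.symm)
  have hpac : pos a ≠ pos c := fun h => hac (hinj ha hc h)
  have hnb : pos b ∉ R.erase (pos b) := by simp
  have hcA : c ∈ (A.erase a).erase b := by simp [hc, hac.symm, hbc.symm]
  refine ⟨⟨(h1.mono (Finset.erase_subset _ _)).attach _ hpab hbR haR, ?_, ?_⟩, ?_⟩
  · intro j z
    rw [Config.degree_attach _ _ _ hpab]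
    by_cases hz : z = pos b ∨ z = pos a
    · have h0 : ¬ Odd ((m j).degree z) := by
        rw [h2]
        rintro ⟨u, hu, -, hp⟩
        simp only [Finset.mem_erase] at hu
        rcases hz with rfl | rfl
        · exact hu.1 (hinj hu.2.2 hb hp)
        · exact hu.2.1 (hinj hu.2.2 ha hp)
      simp only [hz, and_true]
      by_cases hj : j = col b
      · simp only [hj, if_true]
        rw [hj] at h0
        have : Odd ((m (col b)).degree z + 1) := by grind
        refine iff_of_true this ?_
        rcases hz with rfl | rfl
        · exact ⟨b, hb, rfl, rfl⟩
        · exact ⟨a, ha, hcol, rfl⟩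
      · simp only [hj, if_false, add_zero]
        refine iff_of_false h0 ?_
        rintro ⟨u, hu, rfl, hux⟩
        rcases hz with rfl | rfl
        · exact hj (by rw [hinj hu hb hux])
        · exact hj (by rw [hinj hu ha hux, hcol])
    · simp only [hz, and_false, if_false, add_zero, h2]
      push Not at hz
      constructor
      · rintro ⟨u, hu, hc, hp⟩
        exact ⟨u, Finset.mem_of_mem_erase (Finset.mem_of_mem_erase hu), hc, hp⟩
      · rintro ⟨u, hu, hc, hp⟩
        refine ⟨u, ?_, hc, hp⟩
        simp only [Finset.mem_erase]
        refine ⟨?_, ?_, hu⟩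
        · rintro rfl; exact hz.1 hp.symm
        · rintro rfl; exact hz.2 hp.symm
  · -- after contraction of the new edge, every point is connected to a representative in `A \ {a, b}`
    have hrep : ∀ u ∈ A, ∃ u' ∈ (A.erase a).erase b, P u u' ∧
        m.total.graph.Reachable (if pos u = pos b then pos a else pos u) (pos u') := by
      intro u hu
      by_cases hub : u = b
      · subst hub
        refine ⟨c, hcA, P.trans' (P.symm' hPb) hPc, ?_⟩
        simpa using h4.symm
      · rw [if_neg fun h => hub (hinj hu hb h)]
        by_cases hua : u = a
        · subst hua
          exact ⟨c, hcA, hPc, h4.symm⟩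
        · exact ⟨u, by simp [hu, hua, hub], P.refl' u, SimpleGraph.Reachable.refl _⟩
    intro u hu w hw
    rw [Config.reachable_attach h1 _ hnb hpab]
    obtain ⟨u', hu', hPu, hru⟩ := hrep u hu
    obtain ⟨w', hw', hPw, hrw⟩ := hrep w hw
    have := h3 u' hu' w' hw'
    constructor
    · intro h
      exact P.trans' (P.trans' hPu (this.1 ((hru.symm.trans h).trans hrw))) (P.symm' hPw)
    · intro h
      exact (hru.trans (this.2 (P.trans' (P.trans' (P.symm' hPu) h) hPw))).trans hrw.symm
  · rw [Config.total_degree_attach _ _ hpab]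
    have hpos : 0 < m.total.degree (pos a) := by
      obtain ⟨p⟩ := h4.symm
      generalize pos c = z at p hpac
      cases p with
      | nil => exact absurd rfl hpac
      | @cons _ v _ h p =>
        rw [Current.graph_adj] at h
        exact h.trans_le (Finset.single_le_sum (f := fun y => m.total.val (pos a) y)
          (fun _ _ => Nat.zero_le _) (Finset.mem_univ v))
    simp only [or_true, if_true]
    omega

end Events

/-! ### Lower bounds on the masses of events -/

section LowerBound

variable {V ι : Type*} [DecidableEq V] {col : ι → Bool} {P : Setoid ι} {A : Finset ι}

theorem mem_free_iff {R F : Finset V} {pos : ι → V} {y : V} :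
    y ∈ (R \ A.image pos) \ F ↔ y ∈ R ∧ (∀ u ∈ A, pos u ≠ y) ∧ y ∉ F := by
  simp [and_assoc]

open scoped Classical in
/-- Every class of `P` contains an even number of points of `A` of each colour. -/
def EvenClasses (col : ι → Bool) (P : Setoid ι) (A : Finset ι) : Prop :=
  ∀ x ∈ A, ∀ i, Even (A.filter fun u => P x u ∧ col u = i).card

theorem EvenClasses.exists_ne (h : EvenClasses col P A) {a : ι} (ha : a ∈ A) :
    ∃ b ∈ A, a ≠ b ∧ col a = col b ∧ P a b := by
  classical
  have h1 := h a ha (col a)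
  have hmem : a ∈ A.filter fun u => P a u ∧ col u = col a := by
    simp [ha]
  have h2 : 1 < (A.filter fun u => P a u ∧ col u = col a).card := by
    have : 0 < (A.filter fun u => P a u ∧ col u = col a).card := Finset.card_pos.2 ⟨a, hmem⟩
    obtain ⟨k, hk⟩ := h1
    omega
  obtain ⟨b, hb, hba⟩ := Finset.exists_mem_ne h2 a
  rw [Finset.mem_filter] at hb
  exact ⟨b, hb.1, hba.symm, hb.2.2.symm, hb.2.1⟩

variable [DecidableEq ι]

theorem EvenClasses.erase (h : EvenClasses col P A) {a b : ι} (ha : a ∈ A) (hb : b ∈ A)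
    (hab : a ≠ b) (hcol : col a = col b) (hP : P a b) :
    EvenClasses col P ((A.erase a).erase b) := by
  classical
  intro x hx i
  have hxA : x ∈ A := Finset.mem_of_mem_erase (Finset.mem_of_mem_erase hx)
  have h1 := h x hxA i
  have heq : ((A.erase a).erase b).filter (fun u => P x u ∧ col u = i) =
      ((A.filter fun u => P x u ∧ col u = i).erase a).erase b := by
    ext u
    simp only [Finset.mem_filter, Finset.mem_erase]
    tauto
  rw [heq]
  by_cases hxa : P x a ∧ col a = i
  · have m1 : a ∈ A.filter fun u => P x u ∧ col u = i := by simp [ha, hxa.1, hxa.2]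
    have m2 : b ∈ (A.filter fun u => P x u ∧ col u = i).erase a := by
      simp [hb, hab.symm, P.trans' hxa.1 hP, ← hcol, hxa.2]
    rw [Finset.card_erase_of_mem m2, Finset.card_erase_of_mem m1]
    have : 0 < ((A.filter fun u => P x u ∧ col u = i).erase a).card := Finset.card_pos.2 ⟨b, m2⟩
    rw [Finset.card_erase_of_mem m1] at this
    obtain ⟨k, hk⟩ := h1
    exact ⟨k - 1, by omega⟩
  · have m1 : a ∉ A.filter fun u => P x u ∧ col u = i := by
      simp only [Finset.mem_filter]; tauto
    have m2 : b ∉ A.filter fun u => P x u ∧ col u = i := by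
      simp only [Finset.mem_filter]
      rintro ⟨-, h2, h3⟩
      exact hxa ⟨P.trans' h2 (P.symm' hP), hcol.trans h3⟩
    rw [Finset.erase_eq_of_notMem m1, Finset.erase_eq_of_notMem m2]
    exact h1

variable [Fintype V]

/-- Walking from `c` to `v`: every length of the walk gives a disjoint contribution. -/
theorem le_mass_linkedEvent {d : ℝ} (hd : 0 ≤ d) {c : ι} (hc : c ∈ A) (v : V) {β e : ℝ≥0∞} {r : ℕ}
    (hβ : β ≤ ENNReal.ofReal d * ((r - A.card : ℕ) : ℝ≥0∞))
    (he : ∀ (R : Finset V) (pos : ι → V), Placed R A pos → r ≤ R.card →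
      e ≤ mass d (event col P R A pos))
    (t : ℕ) {R : Finset V} {pos : ι → V} (hpos : Placed R A pos) (hv : v ∈ R)
    (hvA : ∀ u ∈ A, pos u ≠ v) (hR : r + 1 + t ≤ R.card) :
    ENNReal.ofReal d * e * ∑ j ∈ Finset.range (t + 1), β ^ j ≤
      mass d (linkedEvent col P R A c v pos) := by
  refine geom_sum_le_of_step (fun R pos => mass d (linkedEvent col P R A c v pos)) hc {v}
    (ENNReal.ofReal d) β (ENNReal.ofReal d * e) (r + 1) (by simpa using hβ) ?_ t R pos hpos
    (by simpa using hv) (by simpa using hvA) hR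
  intro R pos hpos h3 h4 h5
  obtain ⟨h1, h2⟩ := id hpos
  have hvR : v ∈ R := by simpa using h3
  have hvA : ∀ u ∈ A, pos u ≠ v := by simpa using h4
  classical
  let Y : Finset V := insert v ((R \ A.image pos) \ {v})
  let F : V → Set (Config V) := fun y =>
    if y = v then event col P (R.erase (pos c)) A (Function.update pos c y)
    else linkedEvent col P (R.erase (pos c)) A c v (Function.update pos c y)
  have hY : ∀ y ∈ Y, y ∈ R ∧ ∀ u ∈ A, pos u ≠ y := by
    intro y hy
    rcases Finset.mem_insert.1 hy with rfl | hy
    · exact ⟨hvR, hvA⟩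
    · exact ⟨(mem_free_iff.1 hy).1, (mem_free_iff.1 hy).2.1⟩
  have hF : ∀ y, ∀ m ∈ F y,
      m ∈ event col P (R.erase (pos c)) A (Function.update pos c y) ∧
        m.total.graph.Reachable y v := by
    intro y m hm
    by_cases hyv : y = v
    · simp only [F, hyv, if_true] at hm ⊢
      exact ⟨hm, SimpleGraph.Reachable.refl _⟩
    · simp only [F, hyv, if_false] at hm
      exact ⟨hm.1, by simpa using hm.2⟩
  have key := sum_mass_le_of_attach hd (R := R.erase (pos c)) (Y := Y) (a := pos c) (by simp)
    (fun h => (hY _ h).2 c hc rfl) (col c) F (linkedEvent col P R A c v pos)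
    (fun y _ m hm => (hF y m hm).1.1)
    (fun y hy m hm => attach_mem_linkedEvent_of_move hc h2 (h1 c hc) (hvA c hc).symm (hY y hy).1
      (hY y hy).2 (hF y m hm).1 (hF y m hm).2)
  refine le_trans ?_ key
  rw [Finset.sum_insert (by simp)]
  refine add_le_add ?_ (Finset.sum_le_sum fun y hy => ?_)
  · simp only [F, if_true]
    refine mul_le_mul_right (he _ _ (hpos.update hc hvR hvA) ?_) _
    rw [Finset.card_erase_of_mem (h1 c hc)]; omega
  · have hyv : y ≠ v := by simpa using (mem_free_iff.1 hy).2.2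
    simp only [F, hyv, if_false]
    exact le_rfl

/-- Walking from `b` to `a`, which is connected to the third point `c`. -/
theorem le_mass_branchEvent {d : ℝ} (hd : 0 ≤ d) {a b c : ι} (ha : a ∈ A) (hb : b ∈ A)
    (hc : c ∈ A) (hab : a ≠ b) (hac : a ≠ c) (hbc : b ≠ c) (hcol : col a = col b) (hPb : P a b)
    (hPc : P a c) {β e : ℝ≥0∞} {r : ℕ}
    (hβ : β ≤ ENNReal.ofReal d * ((r - A.card : ℕ) : ℝ≥0∞))
    (he : ∀ (R : Finset V) (pos : ι → V) (v : V), Placed R ((A.erase a).erase b) pos → v ∈ R →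
      (∀ u ∈ (A.erase a).erase b, pos u ≠ v) → r ≤ R.card →
      e ≤ mass d (linkedEvent col P R ((A.erase a).erase b) c v pos))
    (t : ℕ) {R : Finset V} {pos : ι → V} (hpos : Placed R A pos) (hR : r + 1 + t ≤ R.card) :
    ENNReal.ofReal d * e * ∑ j ∈ Finset.range (t + 1), β ^ j ≤
      mass d (branchEvent col P R A a pos) := by
  have hβ' : β ≤ ENNReal.ofReal d * ((r + 1 - (A.card + (∅ : Finset V).card) : ℕ) : ℝ≥0∞) := by
    refine hβ.trans ?_
    gcongr <;> simp
  refine geom_sum_le_of_step (fun R pos => mass d (branchEvent col P R A a pos)) hb ∅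
    (ENNReal.ofReal d) β (ENNReal.ofReal d * e) (r + 1) hβ' ?_ t R pos hpos
    (by simp) (by simp) hR
  intro R pos hpos _ _ h5
  obtain ⟨h1, h2⟩ := id hpos
  classical
  let Y : Finset V := insert (pos a) ((R \ A.image pos) \ ∅)
  let F : V → Set (Config V) := fun y =>
    if y = pos a then linkedEvent col P (R.erase (pos b)) ((A.erase a).erase b) c (pos a) pos
    else branchEvent col P (R.erase (pos b)) A a (Function.update pos b y)
  have hfree : ∀ y ∈ (R \ A.image pos) \ ∅, y ≠ pos a := fun y hy h =>
    (mem_free_iff.1 hy).2.1 a ha h.symm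
  have hpab : pos a ≠ pos b := fun h => hab (h2 ha hb h)
  have key := sum_mass_le_of_attach hd (R := R.erase (pos b)) (Y := Y) (a := pos b) (by simp)
    (by
      simp only [Y, Finset.mem_insert, not_or]
      exact ⟨hpab.symm, fun h => (mem_free_iff.1 h).2.1 b hb rfl⟩)
    (col b) F (branchEvent col P R A a pos)
    (fun y hy m hm => by
      by_cases hya : y = pos a
      · simp only [F, hya, if_true] at hm
        exact hm.1.1
      · simp only [F, hya, if_false] at hm
        exact hm.1.1)
    (fun y hy m hm => by
      by_cases hya : y = pos a
      · simp only [F, hya, if_true] at hm ⊢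
        exact attach_mem_branchEvent_of_hit ha hb hc hab hac hbc hcol hPb hPc h2 (h1 a ha)
          (h1 b hb) hm
      · simp only [F, hya, if_false] at hm
        have hy' := (Finset.mem_insert.1 hy).resolve_left hya
        exact attach_mem_branchEvent_of_move ha hb hab h2 (h1 b hb) (mem_free_iff.1 hy').1
          (mem_free_iff.1 hy').2.1 hm)
  refine le_trans ?_ key
  rw [Finset.sum_insert (fun h => hfree _ h rfl)]
  refine add_le_add ?_ (Finset.sum_le_sum fun y hy => ?_)
  · simp only [F, if_true]
    refine mul_le_mul_right (he _ _ _ ?_ ?_ ?_ ?_) _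
    · have := hpos.erase hb
      exact ⟨fun u hu => this.1 u (by simp only [Finset.mem_erase] at hu ⊢; tauto),
        h2.mono (by intro u; simp only [Finset.coe_erase]; simp +contextual)⟩
    · rw [Finset.mem_erase]; exact ⟨hpab, h1 a ha⟩
    · intro u hu h
      simp only [Finset.mem_erase] at hu
      exact hu.2.1 (h2 hu.2.2 ha h)
    · rw [Finset.card_erase_of_mem (h1 b hb)]; omega
  · simp only [F, hfree y hy, if_false]
    exact le_rfl

/-- Walking from `a` until a vertex that is not the endpoint of a pendant edge. -/
theorem le_mass_event_of_branchEvent {d : ℝ} (hd : 0 ≤ d) {a : ι} (ha : a ∈ A) {β e : ℝ≥0∞} {r : ℕ}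
    (hβ : β ≤ ENNReal.ofReal d * ((r - A.card : ℕ) : ℝ≥0∞))
    (he : ∀ (R : Finset V) (pos : ι → V), Placed R A pos → r ≤ R.card →
      e ≤ mass d (branchEvent col P R A a pos))
    (t : ℕ) {R : Finset V} {pos : ι → V} (hpos : Placed R A pos) (hR : r + t ≤ R.card) :
    e * ∑ j ∈ Finset.range (t + 1), β ^ j ≤ mass d (event col P R A pos) := by
  refine geom_sum_le_of_step (fun R pos => mass d (event col P R A pos)) ha ∅
    (ENNReal.ofReal d) β e r (by simpa using hβ) ?_ t R pos hpos
    (by simp) (by simp) hR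
  intro R pos hpos _ _ h5
  obtain ⟨h1, h2⟩ := id hpos
  refine le_trans (add_le_add (he R pos hpos h5) le_rfl) ?_
  refine mass_add_sum_le_of_attach hd (R := R.erase (pos a)) (by simp)
    (fun h => (mem_free_iff.1 h).2.1 a ha rfl) (col a)
    (fun y => event col P (R.erase (pos a)) A (Function.update pos a y)) _ _
    (fun y _ m hm => hm.1)
    (fun y hy m hm => attach_mem_event_of_move ha h2 (h1 a ha) (mem_free_iff.1 hy).1
      (mem_free_iff.1 hy).2.1 hm) (fun m hm => hm.1) ?_
  rintro y hy m hm ⟨-, hdeg⟩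
  refine hdeg ?_
  have hay : pos a ≠ y := (mem_free_iff.1 hy).2.1 a ha
  rw [Config.total_degree_attach _ _ hay, hm.1.total.degree_eq_zero (by simp)]
  simp

/-- Walking from `a` to `b`, when `a` and `b` form a class of the partition. -/
theorem le_mass_event_of_pair {d : ℝ} (hd : 0 ≤ d) {a b : ι} (ha : a ∈ A) (hb : b ∈ A)
    (hab : a ≠ b) (hcol : col a = col b) (hP : P a b) (hclass : ∀ u ∈ A, P a u → u = a ∨ u = b)
    {β e : ℝ≥0∞} {r : ℕ} (hβ : β ≤ ENNReal.ofReal d * ((r - A.card : ℕ) : ℝ≥0∞))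
    (he : ∀ (R : Finset V) (pos : ι → V), Placed R ((A.erase a).erase b) pos → r ≤ R.card →
      e ≤ mass d (event col P R ((A.erase a).erase b) pos))
    (t : ℕ) {R : Finset V} {pos : ι → V} (hpos : Placed R A pos) (hR : r + 2 + t ≤ R.card) :
    ENNReal.ofReal d * e * ∑ j ∈ Finset.range (t + 1), β ^ j ≤ mass d (event col P R A pos) := by
  have hβ' : β ≤ ENNReal.ofReal d * ((r + 2 - (A.card + (∅ : Finset V).card) : ℕ) : ℝ≥0∞) := by
    refine hβ.trans ?_
    gcongr <;> simp
  refine geom_sum_le_of_step (fun R pos => mass d (event col P R A pos)) ha ∅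
    (ENNReal.ofReal d) β (ENNReal.ofReal d * e) (r + 2) hβ' ?_ t R pos hpos
    (by simp) (by simp) hR
  intro R pos hpos _ _ h5
  obtain ⟨h1, h2⟩ := id hpos
  classical
  let Y : Finset V := insert (pos b) ((R \ A.image pos) \ ∅)
  let F : V → Set (Config V) := fun y =>
    if y = pos b then event col P ((R.erase (pos a)).erase (pos b)) ((A.erase a).erase b) pos
    else event col P (R.erase (pos a)) A (Function.update pos a y)
  have hfree : ∀ y ∈ (R \ A.image pos) \ ∅, y ≠ pos b := fun y hy h =>
    (mem_free_iff.1 hy).2.1 b hb h.symm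
  have hpab : pos a ≠ pos b := fun h => hab (h2 ha hb h)
  have key := sum_mass_le_of_attach hd (R := R.erase (pos a)) (Y := Y) (a := pos a) (by simp)
    (by
      simp only [Y, Finset.mem_insert, not_or]
      exact ⟨hpab, fun h => (mem_free_iff.1 h).2.1 a ha rfl⟩)
    (col a) F (event col P R A pos)
    (fun y hy m hm => by
      by_cases hya : y = pos b
      · simp only [F, hya, if_true] at hm
        exact hm.1.mono (Finset.erase_subset _ _)
      · simp only [F, hya, if_false] at hm
        exact hm.1)
    (fun y hy m hm => by
      by_cases hya : y = pos b
      · simp only [F, hya, if_true] at hm ⊢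
        exact attach_mem_event_of_pair ha hb hab hcol hP hclass h2 (h1 a ha) (h1 b hb) hm
      · simp only [F, hya, if_false] at hm
        have hy' := (Finset.mem_insert.1 hy).resolve_left hya
        exact attach_mem_event_of_move ha h2 (h1 a ha) (mem_free_iff.1 hy').1
          (mem_free_iff.1 hy').2.1 hm)
  refine le_trans ?_ key
  rw [Finset.sum_insert (fun h => hfree _ h rfl)]
  refine add_le_add ?_ (Finset.sum_le_sum fun y hy => ?_)
  · simp only [F, if_true]
    refine mul_le_mul_right (he _ _ ((hpos.erase ha).erase (by simp [hb, hab.symm])) ?_) _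
    rw [Finset.card_erase_of_mem (by simp [hpab.symm, h1 b hb]),
      Finset.card_erase_of_mem (h1 a ha)]
    omega
  · simp only [F, hfree y hy, if_false]
    exact le_rfl

/-- Eliminating the points two by two: a class with two points is traversed by one walk, and in a
larger class two points of the same colour and a third point are merged by three walks. -/
theorem le_mass_event {d : ℝ} (hd : 0 ≤ d) {β γ e : ℝ≥0∞} {r K : ℕ} (t : ℕ)
    (hβ : β ≤ ENNReal.ofReal d * ((r - K : ℕ) : ℝ≥0∞))
    (hγ₁ : γ ≤ ENNReal.ofReal d * ∑ j ∈ Finset.range (t + 1), β ^ j)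
    (hγ₃ : γ ≤ ENNReal.ofReal d ^ 2 * (∑ j ∈ Finset.range (t + 1), β ^ j) ^ 3)
    (he : ∀ (R : Finset V) (pos : ι → V), r ≤ R.card → e ≤ mass d (event col P R ∅ pos)) :
    ∀ (k : ℕ) (A : Finset ι), A.card = 2 * k → 2 * k ≤ K → EvenClasses col P A →
      ∀ (R : Finset V) (pos : ι → V), Placed R A pos → r + k * (3 * t + 2) ≤ R.card →
        γ ^ k * e ≤ mass d (event col P R A pos) := by
  intro k
  induction k with
  | zero =>
    intro A hA _ _ R pos _ hR
    have : A = ∅ := by simpa using hA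
    subst this
    simpa using he R pos (by omega)
  | succ k ih =>
    intro A hA hK hE R pos hpos hR
    obtain ⟨a, ha⟩ : A.Nonempty := Finset.card_pos.1 (by omega)
    obtain ⟨b, hb, hab, hcol, hP⟩ := hE.exists_ne ha
    have hE' := hE.erase ha hb hab hcol hP
    have hcard : ((A.erase a).erase b).card = 2 * k := by
      rw [Finset.card_erase_of_mem (by simp [hb, hab.symm]), Finset.card_erase_of_mem ha]
      omega
    have ih' := ih _ hcard (by omega) hE'
    have hβ' : ∀ r' n : ℕ, r ≤ r' → n ≤ K → β ≤ ENNReal.ofReal d * ((r' - n : ℕ) : ℝ≥0∞) := by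
      intro r' n h1 h2
      refine hβ.trans ?_
      gcongr
    have hexp : (k + 1) * (3 * t + 2) = k * (3 * t + 2) + (3 * t + 2) := by ring
    rw [hexp] at hR
    by_cases hclass : ∀ u ∈ A, P a u → u = a ∨ u = b
    · refine le_trans ?_ (le_mass_event_of_pair hd ha hb hab hcol hP hclass
        (hβ' (r + k * (3 * t + 2)) A.card (by omega) (by omega))
        (fun R pos h1 h2 => ih' R pos h1 h2) t hpos (by omega))
      calc γ ^ (k + 1) * e = γ * (γ ^ k * e) := by ring
        _ ≤ (ENNReal.ofReal d * ∑ j ∈ Finset.range (t + 1), β ^ j) * (γ ^ k * e) := by gcongr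
        _ = _ := by ring
    · push Not at hclass
      obtain ⟨c, hc, hPc, hca, hcb⟩ := hclass
      have hcA : c ∈ (A.erase a).erase b := by simp [hc, hca, hcb]
      refine le_trans ?_ (le_mass_event_of_branchEvent hd ha
        (hβ' (r + k * (3 * t + 2) + 1 + t + 1 + t) A.card (by omega) (by omega))
        (fun R pos h1 h2 => le_mass_branchEvent hd ha hb hc hab hca.symm hcb.symm hcol hP hPc
          (hβ' (r + k * (3 * t + 2) + 1 + t) A.card (by omega) (by omega))
          (fun R pos v h1 hv hvA h2 => le_mass_linkedEvent hd hcA v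
            (hβ' (r + k * (3 * t + 2)) _ (by omega) (by omega))
            (fun R pos h1 h2 => ih' R pos h1 h2) t h1 hv hvA h2) t h1 h2) t hpos (by omega))
      generalize ∑ j ∈ Finset.range (t + 1), β ^ j = S at *
      calc γ ^ (k + 1) * e = γ * (γ ^ k * e) := by ring
        _ ≤ (ENNReal.ofReal d ^ 2 * S ^ 3) * (γ ^ k * e) := by gcongr
        _ = _ := by ring

end LowerBound

/-! ### The random current expansion -/

theorem hasSum_fin_pi_prod {n : ℕ} (f : Fin n → ℕ → ℝ) (hf : ∀ i, Summable fun k => ‖f i k‖) :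
    (Summable fun k : Fin n → ℕ => ‖∏ i, f i (k i)‖) ∧
      HasSum (fun k : Fin n → ℕ => ∏ i, f i (k i)) (∏ i, ∑' k, f i k) := by
  induction n with
  | zero =>
    refine ⟨(hasSum_unique _).summable, ?_⟩
    simp only [Finset.univ_eq_empty, Finset.prod_empty]
    exact hasSum_unique (fun _ : Fin 0 → ℕ => (1 : ℝ))
  | succ n ih =>
    obtain ⟨h1, h2⟩ := ih (fun i => f i.succ) (fun i => hf i.succ)
    have hs : Summable fun p : ℕ × (Fin n → ℕ) => ‖f 0 p.1 * ∏ i, f (Fin.succ i) (p.2 i)‖ :=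
      Summable.mul_norm (f := f 0) (g := fun k : Fin n → ℕ => ∏ i, f (Fin.succ i) (k i)) (hf 0) h1
    have hfun : ∀ p : ℕ × (Fin n → ℕ), ∏ i, f i (Fin.consEquiv (fun _ => ℕ) p i) =
        f 0 p.1 * ∏ i, f (Fin.succ i) (p.2 i) := by
      intro p
      simp [Fin.prod_univ_succ, Fin.consEquiv]
    constructor
    · rw [← (Fin.consEquiv fun _ => ℕ).summable_iff]
      refine hs.congr fun p => ?_
      rw [Function.comp_apply, hfun]
    · rw [← (Fin.consEquiv fun _ => ℕ).hasSum_iff, Fin.prod_univ_succ]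
      refine Eq.mp (congrArg (fun F => HasSum F _) (funext fun p => ?_))
        (HasSum.mul (hf 0).of_norm.hasSum h2 hs.of_norm)
      rw [Function.comp_apply, hfun]

/-- A product of absolutely convergent series is the sum over all choices of one term each. -/
theorem hasSum_pi_prod {ι : Type*} [Fintype ι] (f : ι → ℕ → ℝ)
    (hf : ∀ i, Summable fun k => ‖f i k‖) :
    HasSum (fun n : ι → ℕ => ∏ i, f i (n i)) (∏ i, ∑' k, f i k) := by
  classical
  let e := Fintype.equivFin ι
  have h := (hasSum_fin_pi_prod (fun i => f (e.symm i)) (fun i => hf (e.symm i))).2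
  rw [← (Equiv.arrowCongr e (Equiv.refl ℕ)).hasSum_iff,
    Equiv.prod_comp e.symm fun i => ∑' k, f i k] at h
  refine Eq.mp (congrArg (fun F => HasSum F _) (funext fun n => ?_)) h
  simp only [Function.comp_apply, Equiv.arrowCongr_apply, Equiv.coe_refl, id_eq]
  exact Equiv.prod_comp e.symm fun i => f i (n i)

section Expansion

variable {V : Type*} [Fintype V] [DecidableEq V]

theorem sum_incident {M : Type*} [AddCommMonoid M] (f : {e : Sym2 V // ¬ e.IsDiag} → M) (x : V) :
    ∑ y, (if h : ¬ (s(x, y)).IsDiag then f ⟨s(x, y), h⟩ else 0) =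
      ∑ e, if x ∈ e.1 then f e else 0 := by
  classical
  rw [← Finset.sum_filter (s := Finset.univ) (p := fun e : {e : Sym2 V // ¬ e.IsDiag} => x ∈ e.1),
    Finset.sum_dite]
  simp only [Finset.sum_const_zero, add_zero]
  refine Finset.sum_bij (fun y hy => ⟨s(x, y.1), by simpa using y.2⟩) ?_ ?_ ?_ ?_
  · intro y _; simp
  · intro y _ y' _ h
    have := congrArg Subtype.val h
    simp only [Sym2.congr_right] at this
    exact Subtype.ext this
  · rintro ⟨e, he⟩ hx
    simp only [Finset.mem_filter, Finset.mem_univ, true_and] at hx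
    obtain ⟨y, rfl⟩ := hx
    exact ⟨⟨y, by simpa using he⟩, by simp, rfl⟩
  · intro y _; rfl

theorem Current.degree_eq_sum_edges (n : Current V) (x : V) :
    n.degree x = ∑ e, if x ∈ e.1 then n e else 0 := sum_incident n x

/-- The spin `± 1` encoded by a Boolean. -/
def spin (b : Bool) : ℝ := if b then 1 else -1

@[simp] theorem spin_mul_self (b : Bool) : spin b * spin b = 1 := by cases b <;> simp [spin]

@[simp] theorem spin_sq (b : Bool) : spin b ^ 2 = 1 := by cases b <;> simp [spin]

@[simp] theorem abs_spin (b : Bool) : |spin b| = 1 := by cases b <;> simp [spin]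

theorem spin_not (b : Bool) : spin (!b) = -spin b := by cases b <;> simp [spin]

/-- The product of the spins at the two endpoints of an edge. -/
def edgeSpin (σ : V → Bool) (e : Sym2 V) : ℝ := ∏ x, if x ∈ e then spin (σ x) else 1

theorem sum_prod_spin_pow (k : V → ℕ) :
    ∑ σ : V → Bool, ∏ x, spin (σ x) ^ k x =
      if ∀ x, Even (k x) then (2 : ℝ) ^ Fintype.card V else 0 := by
  classical
  have h := Finset.prod_univ_sum (fun _ : V => (Finset.univ : Finset Bool))
    (fun x b => spin b ^ k x)
  rw [Fintype.piFinset_univ] at h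
  rw [← h]
  have hx : ∀ x, ∑ b, spin b ^ k x = if Even (k x) then (2 : ℝ) else 0 := by
    intro x
    split_ifs with he
    · simp [spin, he.neg_one_pow, one_add_one_eq_two]
    · simp [spin, (Nat.not_even_iff_odd.1 he).neg_one_pow]
  simp only [hx]
  split_ifs with hall
  · simp [hall]
  · push Not at hall
    obtain ⟨x, hx⟩ := hall
    exact Finset.prod_eq_zero (Finset.mem_univ x) (by simp [hx])

theorem prod_edgeSpin_pow (n : Current V) (σ : V → Bool) :
    ∏ e, edgeSpin σ e.1 ^ n e = ∏ x, spin (σ x) ^ n.degree x := by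
  simp only [edgeSpin, ← Finset.prod_pow]
  rw [Finset.prod_comm]
  refine Finset.prod_congr rfl fun x _ => ?_
  rw [Current.degree_eq_sum_edges, ← Finset.prod_pow_eq_pow_sum]
  refine Finset.prod_congr rfl fun e _ => ?_
  split_ifs <;> simp

/-- The random current expansion of the correlations of the Ising model. -/
theorem hasSum_current (J : {e : Sym2 V // ¬ e.IsDiag} → ℝ) (S : Finset V) :
    HasSum (fun n : Current V => if n.sources = S then ∏ e, J e ^ n e / (n e).factorial else 0)
      (((2 : ℝ) ^ Fintype.card V)⁻¹ * ∑ σ : V → Bool,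
        (∏ x ∈ S, spin (σ x)) * Real.exp (∑ e, J e * edgeSpin σ e.1)) := by
  have hexp : ∀ σ : V → Bool,
      HasSum (fun n : Current V => ∏ e, (J e * edgeSpin σ e.1) ^ n e / (n e).factorial)
        (Real.exp (∑ e, J e * edgeSpin σ e.1)) := by
    intro σ
    have h := (hasSum_pi_prod (fun (e : {e : Sym2 V // ¬ e.IsDiag}) (k : ℕ) =>
      (J e * edgeSpin σ e.1) ^ k / (k.factorial : ℝ)) (fun e =>
        NormedSpace.norm_expSeries_div_summable (J e * edgeSpin σ e.1)))
    rw [Real.exp_sum]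
    convert h using 2 with e
    rw [Real.exp_eq_exp_ℝ, NormedSpace.exp_eq_tsum_div]
  have hsum := (hasSum_sum (s := Finset.univ) fun σ _ =>
    (hexp σ).mul_left (∏ x ∈ S, spin (σ x))).mul_left ((2 : ℝ) ^ Fintype.card V)⁻¹
  refine Eq.mp (congrArg (fun F => HasSum F _) (funext fun n => ?_)) hsum
  have hterm : ∀ σ : V → Bool, (∏ x ∈ S, spin (σ x)) *
      ∏ e, (J e * edgeSpin σ e.1) ^ n e / (n e).factorial =
      (∏ e, J e ^ n e / (n e).factorial) *
        ∏ x, spin (σ x) ^ (n.degree x + if x ∈ S then 1 else 0) := by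
    intro σ
    have h1 : ∏ x ∈ S, spin (σ x) = ∏ x, spin (σ x) ^ (if x ∈ S then 1 else 0) := by
      rw [← Finset.prod_subset (Finset.subset_univ S) fun x _ hx => by simp [hx]]
      exact Finset.prod_congr rfl fun x hx => by simp [hx]
    have h2 : ∏ e, (J e * edgeSpin σ e.1) ^ n e / ((n e).factorial : ℝ) =
        (∏ e, J e ^ n e / ((n e).factorial : ℝ)) * ∏ x, spin (σ x) ^ n.degree x := by
      rw [← prod_edgeSpin_pow, ← Finset.prod_mul_distrib]
      refine Finset.prod_congr rfl fun e _ => ?_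
      rw [mul_pow]; ring
    simp only [pow_add, Finset.prod_mul_distrib]
    rw [h1, h2]
    ring
  rw [Finset.sum_congr rfl fun σ _ => hterm σ, ← Finset.mul_sum, sum_prod_spin_pow]
  have hiff : (∀ x, Even (n.degree x + if x ∈ S then 1 else 0)) ↔ n.sources = S := by
    rw [Finset.ext_iff]
    refine forall_congr' fun x => ?_
    simp only [Current.sources, Finset.mem_filter, Finset.mem_univ, true_and]
    by_cases hx : x ∈ S
    · simp [hx, Nat.even_add_one]
    · simp [hx]
  simp only [hiff]
  split_ifs
  · have : (2 : ℝ) ^ Fintype.card V ≠ 0 := by positivity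
    field_simp
  · simp

end Expansion

/-! ### Current sums as magnetization sums -/

section Magnetization

variable {V : Type*} [Fintype V] [DecidableEq V]

/-- The magnetization of the region `R`. -/
def mag {V : Type*} (R : Finset V) (σ : V → Bool) : ℝ := ∑ x ∈ R, spin (σ x)

theorem edgeSpin_mk (σ : V → Bool) {x y : V} (h : x ≠ y) :
    edgeSpin σ s(x, y) = spin (σ x) * spin (σ y) := by
  unfold edgeSpin
  rw [← Finset.prod_subset (Finset.subset_univ {x, y}) (fun z _ hz => by
    simp only [Finset.mem_insert, Finset.mem_singleton] at hz
    simp [hz]), Finset.prod_pair h]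
  simp

theorem sum_edgeSpin (R : Finset V) (σ : V → Bool) :
    ∑ e : {e : Sym2 V // ¬ e.IsDiag}, (if ∀ v ∈ e.1, v ∈ R then edgeSpin σ e.1 else 0) =
      (mag R σ ^ 2 - R.card) / 2 := by
  classical
  set f : {e : Sym2 V // ¬ e.IsDiag} → ℝ :=
    fun e => if ∀ v ∈ e.1, v ∈ R then edgeSpin σ e.1 else 0 with hf
  have h1 : ∑ x, ∑ e, (if x ∈ e.1 then f e else 0) = ∑ e, 2 * f e := by
    rw [Finset.sum_comm]
    refine Finset.sum_congr rfl fun e _ => ?_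
    obtain ⟨e, he⟩ := e
    rw [← Finset.sum_filter, Finset.sum_const, nsmul_eq_mul]
    congr 1
    have : Finset.filter (fun x => x ∈ e) Finset.univ = e.toFinset := by
      ext; simp
    simp only [this]
    rw [Sym2.card_toFinset_of_not_isDiag _ he]
    norm_num
  have h2 : ∀ x, ∑ e, (if x ∈ e.1 then f e else 0) =
      if x ∈ R then spin (σ x) * mag R σ - 1 else 0 := by
    intro x
    rw [← sum_incident]
    have hterm : ∀ y, (if h : ¬ (s(x, y)).IsDiag then f ⟨s(x, y), h⟩ else 0) =
        if x ∈ R then ((if y ∈ R then spin (σ x) * spin (σ y) else 0) - if y = x then 1 else 0)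
          else 0 := by
      intro y
      by_cases hxy : x = y
      · subst hxy
        by_cases hx : x ∈ R <;> simp [hx]
      · rw [dif_pos (by simpa using hxy)]
        simp only [hf, edgeSpin_mk σ hxy, Sym2.mem_iff, forall_eq_or_imp, forall_eq,
          Ne.symm hxy, if_false, sub_zero]
        by_cases hx : x ∈ R <;> by_cases hy : y ∈ R <;> simp [hx, hy]
    simp only [hterm]
    split_ifs with hx
    · rw [Finset.sum_sub_distrib, Finset.sum_ite_eq' Finset.univ x, ← Finset.sum_filter]
      simp [mag, Finset.mul_sum]
    · simp
  simp only [h2] at h1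
  rw [← Finset.mul_sum, ← Finset.sum_filter] at h1
  simp only [Finset.filter_univ_mem, Finset.sum_sub_distrib, ← Finset.sum_mul,
    Finset.sum_const, nsmul_eq_mul, mul_one] at h1
  have : (∑ x ∈ R, spin (σ x)) = mag R σ := rfl
  rw [this] at h1
  linarith

/-- The sum of `F` against the weights `exp (d * M ^ 2 / 2)` of the Curie-Weiss model, where `M` is
the magnetization of the region `R`. -/
noncomputable def spinSum (d : ℝ) (R : Finset V) (F : (V → Bool) → ℝ) : ℝ :=
  ∑ σ : V → Bool, F σ * Real.exp (d * mag R σ ^ 2 / 2)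

/-- The value, as a sum over spins, of the total weight of the currents on `R` with sources `S`. -/
noncomputable def spinCurrentMass (d : ℝ) (R S : Finset V) : ℝ :=
  ((2 : ℝ) ^ Fintype.card V)⁻¹ * Real.exp (-(d * R.card / 2)) *
    spinSum d R fun σ => ∏ x ∈ S, spin (σ x)

open scoped Classical in
theorem hasSum_weight (d : ℝ) (R S : Finset V) :
    HasSum (fun n : Current V => if n.SupportedOn R ∧ n.sources = S then n.weight d else 0)
      (spinCurrentMass d R S) := by
  have h := hasSum_current (fun e : {e : Sym2 V // ¬ e.IsDiag} =>
    if ∀ v ∈ e.1, v ∈ R then d else 0) S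
  have hval : ((2 : ℝ) ^ Fintype.card V)⁻¹ * ∑ σ : V → Bool, (∏ x ∈ S, spin (σ x)) *
      Real.exp (∑ e : {e : Sym2 V // ¬ e.IsDiag},
        (if ∀ v ∈ e.1, v ∈ R then d else 0) * edgeSpin σ e.1) = spinCurrentMass d R S := by
    rw [spinCurrentMass, spinSum, mul_assoc, Finset.mul_sum (a := Real.exp _)]
    congr 1
    refine Finset.sum_congr rfl fun σ _ => ?_
    have : ∑ e : {e : Sym2 V // ¬ e.IsDiag},
        (if ∀ v ∈ e.1, v ∈ R then d else 0) * edgeSpin σ e.1 =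
        -(d * R.card / 2) + d * mag R σ ^ 2 / 2 := by
      have := sum_edgeSpin R σ
      calc _ = d * ∑ e : {e : Sym2 V // ¬ e.IsDiag},
            (if ∀ v ∈ e.1, v ∈ R then edgeSpin σ e.1 else 0) := by
            rw [Finset.mul_sum]
            refine Finset.sum_congr rfl fun e _ => ?_
            split_ifs <;> simp
        _ = _ := by rw [this]; ring
    rw [this, Real.exp_add]
    ring
  rw [hval] at h
  refine Eq.mp (congrArg (fun F => HasSum F _) (funext fun n => ?_)) h
  by_cases hS : n.sources = S
  · simp only [hS, if_true, and_true]
    split_ifs with hR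
    · refine Finset.prod_congr rfl fun e _ => ?_
      split_ifs with he
      · rfl
      · have : n e = 0 := by
          obtain ⟨e, hdiag⟩ := e
          induction e using Sym2.ind with
          | _ x y =>
            have hxy : x ≠ y := by simpa using hdiag
            by_contra hne
            have hpos : 0 < n.val x y := by
              rw [Current.val_of_ne _ hxy]; exact Nat.pos_of_ne_zero hne
            refine he fun v hv => ?_
            rcases Sym2.mem_iff.1 hv with rfl | rfl
            · exact hR _ _ hpos
            · exact hR _ _ (by rwa [Current.val_comm])
        simp [this]
    · simp only [Current.SupportedOn, not_forall] at hR
      obtain ⟨x, y, hxy, hx⟩ := hR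
      have hne : x ≠ y := by rintro rfl; simp at hxy
      refine Finset.prod_eq_zero (Finset.mem_univ ⟨s(x, y), by simpa using hne⟩) ?_
      rw [Current.val_of_ne _ hne] at hxy
      simp [hx, hxy.ne']
  · simp [hS]

theorem Current.weight_nonneg {d : ℝ} (hd : 0 ≤ d) (n : Current V) : 0 ≤ n.weight d :=
  Finset.prod_nonneg fun _ _ => by positivity

theorem spinCurrentMass_nonneg {d : ℝ} (hd : 0 ≤ d) (R S : Finset V) :
    0 ≤ spinCurrentMass d R S := by
  classical
  refine (hasSum_weight d R S).nonneg fun n => ?_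
  split_ifs
  · exact Current.weight_nonneg hd n
  · exact le_rfl

theorem spinCurrentMass_empty_pos (d : ℝ) (R : Finset V) : 0 < spinCurrentMass d R ∅ := by
  unfold spinCurrentMass spinSum
  have : 0 < ∑ σ : V → Bool, (∏ x ∈ (∅ : Finset V), spin (σ x)) *
      Real.exp (d * mag R σ ^ 2 / 2) :=
    Finset.sum_pos (fun σ _ => by simp [Real.exp_pos]) Finset.univ_nonempty
  positivity

theorem tsum_weight {d : ℝ} (hd : 0 ≤ d) (R S : Finset V) :
    ∑' n : {n : Current V | n.SupportedOn R ∧ n.sources = S}, ENNReal.ofReal (n.1.weight d) =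
      ENNReal.ofReal (spinCurrentMass d R S) := by
  classical
  rw [← (hasSum_weight d R S).tsum_eq, ENNReal.ofReal_tsum_of_nonneg _
    (hasSum_weight d R S).summable,
    tsum_subtype {n : Current V | n.SupportedOn R ∧ n.sources = S}
      fun n => ENNReal.ofReal (n.weight d)]
  · refine tsum_congr fun n => ?_
    simp only [Set.indicator_apply, Set.mem_ofPred_eq]
    split_ifs <;> simp
  · intro n
    split_ifs
    · exact Current.weight_nonneg hd n
    · exact le_rfl

/-- The mass of a product event. -/
theorem mass_prod (d : ℝ) (E F : Set (Current V)) :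
    mass d {m : Config V | m false ∈ E ∧ m true ∈ F} =
      (∑' n : E, ENNReal.ofReal (n.1.weight d)) * ∑' n : F, ENNReal.ofReal (n.1.weight d) := by
  let φ : E × F ≃ {m : Config V | m false ∈ E ∧ m true ∈ F} :=
    { toFun := fun p => ⟨fun b => bif b then p.2.1 else p.1.1, p.1.2, p.2.2⟩
      invFun := fun m => (⟨m.1 false, m.2.1⟩, ⟨m.1 true, m.2.2⟩)
      left_inv := fun p => rfl
      right_inv := fun m => by
        apply Subtype.ext
        funext b
        cases b <;> rfl }
  rw [mass, ← φ.tsum_eq, ENNReal.tsum_prod', ← ENNReal.tsum_mul_right]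
  refine tsum_congr fun n => ?_
  rw [← ENNReal.tsum_mul_left]
  refine tsum_congr fun k => ?_
  simp [φ, Config.weight, mul_comm]

theorem mass_event_empty {ι : Type*} (col : ι → Bool) (P : Setoid ι) {d : ℝ}
    (hd : 0 ≤ d) (R : Finset V) (pos : ι → V) :
    mass d (event col P R ∅ pos) = ENNReal.ofReal (spinCurrentMass d R ∅) ^ 2 := by
  rw [sq, ← tsum_weight hd, ← mass_prod]
  congr 1
  ext m
  simp only [event, Config.SupportedOn, Current.sources, Finset.notMem_empty, false_and,
    exists_false, iff_false, Set.mem_ofPred_eq, Finset.filter_eq_empty_iff, Finset.mem_univ,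
    forall_true_left, Bool.forall_bool, IsEmpty.forall_iff, implies_true, and_true]
  tauto

end Magnetization

/-! ### Moments of the magnetization -/

theorem sinh_le_mul_cosh_sub {y : ℝ} (hy : 0 ≤ y) :
    Real.sinh y ≤ y * Real.cosh y - y ^ 3 / 3 := by
  have hmono : MonotoneOn (fun y => y * Real.cosh y - y ^ 3 / 3 - Real.sinh y) (Set.Ici 0) := by
    have hder : ∀ y : ℝ, HasDerivAt (fun y => y * Real.cosh y - y ^ 3 / 3 - Real.sinh y)
        (y * Real.sinh y - y ^ 2) y := by
      intro y
      have h1 := (((hasDerivAt_id y).mul (Real.hasDerivAt_cosh y)).sub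
        ((hasDerivAt_pow 3 y).div_const 3)).sub (Real.hasDerivAt_sinh y)
      refine h1.congr_deriv ?_
      simp only [id_eq]
      ring
    refine monotoneOn_of_deriv_nonneg (convex_Ici 0) ?_ ?_ ?_
    · exact fun y _ => (hder y).continuousAt.continuousWithinAt
    · exact fun y _ => (hder y).differentiableAt.differentiableWithinAt
    · intro y hy
      rw [interior_Ici] at hy
      rw [(hder y).deriv]
      have := Real.self_le_sinh_iff.2 (le_of_lt hy)
      have hy0 : (0 : ℝ) < y := hy
      nlinarith
  have := hmono (Set.mem_Ici.2 le_rfl) (Set.mem_Ici.2 hy) hy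
  simp at this
  linarith

theorem cosh_le_four {y : ℝ} (hy : |y| ≤ 2) : Real.cosh y ≤ 4 := by
  have h1 : Real.cosh y ≤ Real.cosh 2 :=
    Real.cosh_le_cosh.2 (by rwa [abs_of_pos (a := (2 : ℝ)) two_pos])
  refine h1.trans ?_
  rw [Real.cosh_eq]
  have h2 : Real.exp 2 = Real.exp 1 ^ 2 := by rw [← Real.exp_nat_mul]; norm_num
  have h3 := Real.exp_one_lt_d9
  have h4 : Real.exp (-2) ≤ 1 / 3 := by
    rw [Real.exp_neg, ← one_div]
    exact one_div_le_one_div_of_le (by norm_num) (by linarith [Real.add_one_le_exp (2 : ℝ)])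
  have h5 : Real.exp 1 ^ 2 ≤ (2.7182818286 : ℝ) ^ 2 := by gcongr
  rw [h2]
  norm_num at h5
  linarith

/-- The inequality `y tanh y ≤ y ^ 2 - y ^ 4 / 12` on `[-2, 2]`. -/
theorem mul_sinh_le {y : ℝ} (hy : |y| ≤ 2) :
    y * Real.sinh y ≤ (y ^ 2 - y ^ 4 / 12) * Real.cosh y := by
  wlog h : 0 ≤ y generalizing y
  · have := this (y := -y) (by rwa [abs_neg]) (by linarith)
    simpa [Real.sinh_neg, Real.cosh_neg, Even.neg_pow (by decide : Even 4)] using this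
  have h1 := sinh_le_mul_cosh_sub h
  have h2 := cosh_le_four hy
  have h3 : y * Real.sinh y ≤ y * (y * Real.cosh y - y ^ 3 / 3) := by gcongr
  have h4 : y ^ 4 * Real.cosh y ≤ y ^ 4 * 4 := by gcongr
  nlinarith

section Moments

theorem abs_mag_le {V : Type*} (R : Finset V) (σ : V → Bool) : |mag R σ| ≤ R.card := by
  refine (Finset.abs_sum_le_sum_abs _ _).trans ?_
  simp

variable {V : Type*} [DecidableEq V]

theorem mag_eq_spin_add {R : Finset V} {x : V} (hx : x ∈ R) (σ : V → Bool) :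
    mag R σ = spin (σ x) + mag (R.erase x) σ := (Finset.add_sum_erase _ _ hx).symm

theorem mag_update {R : Finset V} {x : V} (hx : x ∉ R) (σ : V → Bool) (b : Bool) :
    mag R (Function.update σ x b) = mag R σ :=
  Finset.sum_congr rfl fun y hy => by
    rw [Function.update_of_ne fun h : y = x => hx (h ▸ hy)]

variable [Fintype V]

/-- Symmetrization of a sum over spins under the flip of the spin at `x`. -/
theorem sum_flip (x : V) (f : (V → Bool) → ℝ) :
    ∑ σ, f σ = (∑ σ, (f σ + f (Function.update σ x (!σ x)))) / 2 := by
  have hinv : Function.Involutive fun σ : V → Bool => Function.update σ x (!σ x) := by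
    intro σ; simp
  have : ∑ σ, f (Function.update σ x (!σ x)) = ∑ σ, f σ :=
    Equiv.sum_comp hinv.toPerm f
  rw [Finset.sum_add_distrib, this]
  ring

theorem spinSum_add (d : ℝ) (R : Finset V) (F G : (V → Bool) → ℝ) :
    spinSum d R (fun σ => F σ + G σ) = spinSum d R F + spinSum d R G := by
  simp [spinSum, add_mul, Finset.sum_add_distrib]

theorem spinSum_mul (d : ℝ) (R : Finset V) (c : ℝ) (F : (V → Bool) → ℝ) :
    spinSum d R (fun σ => c * F σ) = c * spinSum d R F := by
  simp [spinSum, mul_assoc, Finset.mul_sum]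

theorem spinSum_mono (d : ℝ) (R : Finset V) {F G : (V → Bool) → ℝ} (h : ∀ σ, F σ ≤ G σ) :
    spinSum d R F ≤ spinSum d R G :=
  Finset.sum_le_sum fun σ _ => mul_le_mul_of_nonneg_right (h σ) (Real.exp_pos _).le

theorem spinSum_sum {ι : Type*} (s : Finset ι) (d : ℝ) (R : Finset V)
    (F : ι → (V → Bool) → ℝ) :
    spinSum d R (fun σ => ∑ i ∈ s, F i σ) = ∑ i ∈ s, spinSum d R (F i) := by
  simp only [spinSum, Finset.sum_mul]
  exact Finset.sum_comm

/-- Integrating out the spin at `x`: in mean, `σ_x` is `tanh (d * M_x)`, where `M_x` is the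
magnetization of the other sites. -/
theorem spinSum_spin_mul_le {d : ℝ} (hd : 0 < d) {R : Finset V} (hR : d * R.card ≤ 2) {x : V}
    (hx : x ∈ R) (j : ℕ) :
    spinSum d R (fun σ => spin (σ x) * mag (R.erase x) σ ^ (2 * j + 1)) ≤
      spinSum d R (fun σ => d * mag (R.erase x) σ ^ (2 * j + 2) -
        d ^ 3 / 12 * mag (R.erase x) σ ^ (2 * j + 4)) := by
  rw [← sub_nonpos, spinSum, spinSum, ← Finset.sum_sub_distrib, sum_flip x]
  refine div_nonpos_of_nonpos_of_nonneg (Finset.sum_nonpos fun σ _ => ?_) two_pos.le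
  have hnot : x ∉ R.erase x := by simp
  simp only [mag_eq_spin_add hx, mag_update hnot, Function.update_self, spin_not]
  set s := mag (R.erase x) σ with hs
  have habs : |d * s| ≤ 2 := by
    rw [abs_mul, abs_of_pos hd]
    refine le_trans ?_ hR
    have h1 := abs_mag_le (R.erase x) σ
    have h2 : ((R.erase x).card : ℝ) ≤ R.card := by exact_mod_cast Finset.card_erase_le
    gcongr
    linarith
  have key := mul_sinh_le habs
  have e1 : ∀ ε : ℝ, ε * ε = 1 → Real.exp (d * (ε + s) ^ 2 / 2) =
      Real.exp (d * (1 + s ^ 2) / 2) * Real.exp (ε * (d * s)) := by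
    intro ε hε
    rw [← Real.exp_add]
    congr 1
    linear_combination (d / 2) * hε
  rw [e1 (spin (σ x)) (spin_mul_self _), e1 (-spin (σ x)) (by rw [neg_mul_neg, spin_mul_self])]
  have hpow : 0 ≤ s ^ (2 * j) := by rw [pow_mul]; positivity
  have hmain : 2 * (s * Real.sinh (d * s) - (d * s ^ 2 - d ^ 3 / 12 * s ^ 4) * Real.cosh (d * s))
      ≤ 0 := by
    have : d * (s * Real.sinh (d * s) - (d * s ^ 2 - d ^ 3 / 12 * s ^ 4) * Real.cosh (d * s))
        ≤ 0 := by linarith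
    nlinarith [nonpos_of_mul_nonpos_right this hd]
  have hfin : ∀ b : Bool, spin b * s ^ (2 * j + 1) *
        (Real.exp (d * (1 + s ^ 2) / 2) * Real.exp (spin b * (d * s))) -
      (d * s ^ (2 * j + 2) - d ^ 3 / 12 * s ^ (2 * j + 4)) *
        (Real.exp (d * (1 + s ^ 2) / 2) * Real.exp (spin b * (d * s))) +
      (-spin b * s ^ (2 * j + 1) *
        (Real.exp (d * (1 + s ^ 2) / 2) * Real.exp (-spin b * (d * s))) -
      (d * s ^ (2 * j + 2) - d ^ 3 / 12 * s ^ (2 * j + 4)) *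
        (Real.exp (d * (1 + s ^ 2) / 2) * Real.exp (-spin b * (d * s)))) =
      s ^ (2 * j) * Real.exp (d * (1 + s ^ 2) / 2) *
        (2 * (s * Real.sinh (d * s) -
          (d * s ^ 2 - d ^ 3 / 12 * s ^ 4) * Real.cosh (d * s))) := by
    intro b
    rw [Real.sinh_eq, Real.cosh_eq]
    cases b <;> simp only [spin, if_true, Bool.false_eq_true, if_false, one_mul, neg_mul, neg_neg] <;>
    ring
  rw [hfin]
  exact mul_nonpos_of_nonneg_of_nonpos (by positivity) hmain

/-- The moment inequality for the Curie-Weiss model near the critical point. -/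
theorem moment_inequality {d : ℝ} (hd : 0 < d) {R : Finset V} (hR : d * (R.card + 1) ≤ 2) (j : ℕ) :
    R.card * (d ^ 3 / 12) * spinSum d R (fun σ => |mag R σ| ^ (2 * j + 4)) ≤
      (R.card * d - 1) * spinSum d R (fun σ => |mag R σ| ^ (2 * j + 2)) +
        R.card * (8 * j + 8) * spinSum d R (fun σ => (|mag R σ| + 1) ^ (2 * j)) := by
  have heven : ∀ (k : ℕ) (σ : V → Bool), |mag R σ| ^ (2 * k) = mag R σ ^ (2 * k) := by
    intro k σ; rw [pow_mul, pow_mul, sq_abs]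
  have h4 : ∀ σ : V → Bool, |mag R σ| ^ (2 * j + 4) = mag R σ ^ (2 * j + 4) := heven (j + 2)
  have h2 : ∀ σ : V → Bool, |mag R σ| ^ (2 * j + 2) = mag R σ ^ (2 * j + 2) := heven (j + 1)
  have hx : ∀ x ∈ R, spinSum d R (fun σ => spin (σ x) * mag R σ ^ (2 * j + 1)) ≤
      d * spinSum d R (fun σ => mag R σ ^ (2 * j + 2)) +
      (-(d ^ 3 / 12)) * spinSum d R (fun σ => mag R σ ^ (2 * j + 4)) +
      (8 * j + 8) * spinSum d R (fun σ => (|mag R σ| + 1) ^ (2 * j)) := by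
    intro x hx
    -- replacing `M` by `M_x` in each of the three terms costs `O((|M| + 1) ^ (2 * j))`
    have hstep := spinSum_spin_mul_le hd (by nlinarith) hx j
    rw [← spinSum_mul, ← spinSum_mul, ← spinSum_mul, ← spinSum_add, ← spinSum_add]
    have hdiff : spinSum d R (fun σ => spin (σ x) * mag R σ ^ (2 * j + 1)) +
        spinSum d R (fun σ => d * mag (R.erase x) σ ^ (2 * j + 2) -
        d ^ 3 / 12 * mag (R.erase x) σ ^ (2 * j + 4)) ≤
        spinSum d R (fun σ => d * mag R σ ^ (2 * j + 2) +
          -(d ^ 3 / 12) * mag R σ ^ (2 * j + 4) + (8 * j + 8) * (|mag R σ| + 1) ^ (2 * j)) +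
        spinSum d R (fun σ => spin (σ x) * mag (R.erase x) σ ^ (2 * j + 1)) := by
      rw [← spinSum_add, ← spinSum_add]
      refine spinSum_mono d R fun σ => ?_
      have hm := mag_eq_spin_add hx σ
      set M := mag R σ
      set s := mag (R.erase x) σ
      have hε := abs_spin (σ x)
      set ε := spin (σ x)
      have hsabs : |s| ≤ |M| + 1 := by
        have : s = M - ε := by linarith
        rw [this]
        exact (abs_sub _ _).trans (by rw [hε])
      have hmax : max |M| |s| ≤ |M| + 1 := max_le (by linarith) hsabs
      have hpow : ∀ m : ℕ, |M ^ (m + 1) - s ^ (m + 1)| ≤ (m + 1) * (|M| + 1) ^ m := by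
        intro m
        have h := abs_pow_sub_pow_le M s (m + 1)
        have h1 : |M - s| = 1 := by rw [hm, add_sub_cancel_right, hε]
        rw [h1, one_mul, Nat.add_sub_cancel] at h
        refine h.trans ?_
        push_cast
        gcongr
      have hM : |M| ≤ R.card := abs_mag_le R σ
      set w := |M| + 1 with hw
      have hw0 : 0 ≤ w := by positivity
      have hdw : d * w ≤ 2 := le_trans (by gcongr; linarith) hR
      have hdw0 : 0 ≤ d * w := by positivity
      have p1 : ε * M ^ (2 * j + 1) - ε * s ^ (2 * j + 1) ≤ (2 * j + 1) * w ^ (2 * j) := by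
        have h := hpow (2 * j)
        push_cast at h
        calc _ ≤ |ε * (M ^ (2 * j + 1) - s ^ (2 * j + 1))| := by
              rw [mul_sub]; exact le_abs_self _
          _ ≤ _ := by rw [abs_mul, hε, one_mul]; exact h
      have hj : (0 : ℝ) ≤ j := Nat.cast_nonneg j
      have hwj : 0 ≤ w ^ (2 * j) := by positivity
      have p2 : d * s ^ (2 * j + 2) - d * M ^ (2 * j + 2) ≤ 2 * (2 * j + 2) * w ^ (2 * j) := by
        have h := (neg_le_abs _).trans (hpow (2 * j + 1))
        push_cast at h
        have h' : d * (s ^ (2 * j + 2) - M ^ (2 * j + 2)) ≤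
            d * ((2 * j + 1 + 1) * w ^ (2 * j + 1)) := by
          refine mul_le_mul_of_nonneg_left ?_ hd.le
          linarith
        have h3 : d * ((2 * j + 1 + 1) * w ^ (2 * j + 1)) =
            (d * w) * ((2 * j + 2) * w ^ (2 * j)) := by ring
        have h4 : (d * w) * ((2 * j + 2) * w ^ (2 * j)) ≤ 2 * ((2 * j + 2) * w ^ (2 * j)) := by
          gcongr
        linarith
      have p3 : d ^ 3 / 12 * M ^ (2 * j + 4) - d ^ 3 / 12 * s ^ (2 * j + 4) ≤
          8 / 12 * (2 * j + 4) * w ^ (2 * j) := by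
        have h := (le_abs_self _).trans (hpow (2 * j + 3))
        push_cast at h
        have h' : d ^ 3 / 12 * (M ^ (2 * j + 4) - s ^ (2 * j + 4)) ≤
            d ^ 3 / 12 * ((2 * j + 3 + 1) * w ^ (2 * j + 3)) := by
          refine mul_le_mul_of_nonneg_left ?_ (by positivity)
          linarith
        have h3 : d ^ 3 / 12 * ((2 * j + 3 + 1) * w ^ (2 * j + 3)) =
            (d * w) ^ 3 * ((2 * j + 4) / 12 * w ^ (2 * j)) := by ring
        have h4 : (d * w) ^ 3 * ((2 * j + 4) / 12 * w ^ (2 * j)) ≤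
            2 ^ 3 * ((2 * j + 4) / 12 * w ^ (2 * j)) := by
          gcongr
        linarith
      have p4 : (2 * j + 1) * w ^ (2 * j) + 2 * (2 * j + 2) * w ^ (2 * j) +
          8 / 12 * (2 * j + 4) * w ^ (2 * j) ≤ (8 * j + 8) * w ^ (2 * j) := by
        nlinarith [mul_nonneg hj hwj]
      linarith
    linarith
  have hsum := Finset.sum_le_sum hx
  rw [← spinSum_sum, Finset.sum_const, nsmul_eq_mul] at hsum
  have heq : ∀ σ : V → Bool, ∑ x ∈ R, spin (σ x) * mag R σ ^ (2 * j + 1) =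
      mag R σ ^ (2 * j + 2) := by
    intro σ
    rw [← Finset.sum_mul]
    change mag R σ * mag R σ ^ (2 * j + 1) = _
    ring
  simp only [heq] at hsum
  simp only [h4, h2]
  linarith

theorem exists_mul_pow_le (B : ℝ) (hB : 0 ≤ B) (m : ℕ) :
    ∃ K : ℝ, 0 ≤ K ∧ ∀ v : ℝ, 0 ≤ v → B * (v + 1) ^ m ≤ v ^ (m + 2) / 2 + K := by
  refine ⟨B * (1 + 2 ^ (m + 1) * B + 1) ^ m, by positivity, fun v hv => ?_⟩
  rcases le_total v (1 + 2 ^ (m + 1) * B) with h | h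
  · have : B * (v + 1) ^ m ≤ B * (1 + 2 ^ (m + 1) * B + 1) ^ m := by gcongr
    have : 0 ≤ v ^ (m + 2) := by positivity
    linarith
  · have h0 : 0 ≤ 2 ^ (m + 1) * B := by positivity
    have h1 : 1 ≤ v := by linarith
    have h2 : 2 ^ (m + 1) * B ≤ v ^ 2 := by nlinarith
    have h3 : (v + 1) ^ m ≤ 2 ^ m * v ^ m := by
      rw [← mul_pow]
      gcongr
      linarith
    have h4 : B * (v + 1) ^ m ≤ B * (2 ^ m * v ^ m) := by gcongr
    have h5 : 2 ^ (m + 1) * B * v ^ m ≤ v ^ 2 * v ^ m := by gcongr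
    have h6 : 0 ≤ B * (1 + 2 ^ (m + 1) * B + 1) ^ m := by positivity
    have h7 : v ^ (m + 2) = v ^ 2 * v ^ m := by ring
    have h8 : (2 : ℝ) ^ (m + 1) * B * v ^ m = 2 * (B * (2 ^ m * v ^ m)) := by ring
    linarith

end Moments

/-- In the critical window, the magnetization of `N = q ^ 4` spins is of order `q ^ 3`. -/
theorem exists_moment_le (α : ℝ) (hα : 0 ≤ α) (k : ℕ) :
    ∃ K : ℝ, 0 ≤ K ∧ ∀ (V : Type u) [Fintype V] [DecidableEq V] (R : Finset V) (d q : ℝ),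
      1 ≤ q → 0 < d → d * (R.card + 1) ≤ 2 → 1 / (16 * q ^ 8) ≤ R.card * d ^ 3 →
      (R.card : ℝ) ≤ q ^ 4 → R.card * d - 1 ≤ α / q ^ 2 →
      spinSum d R (fun σ => |mag R σ| ^ (2 * k)) ≤ K * q ^ (6 * k) * spinSum d R fun _ => 1 := by
  -- the moments of order at least four, from the moment inequality
  have main : ∀ j : ℕ, ∃ K : ℝ, 0 ≤ K ∧
      ∀ (V : Type u) [Fintype V] [DecidableEq V] (R : Finset V) (d q : ℝ),
      1 ≤ q → 0 < d → d * (R.card + 1) ≤ 2 → 1 / (16 * q ^ 8) ≤ R.card * d ^ 3 →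
      (R.card : ℝ) ≤ q ^ 4 → R.card * d - 1 ≤ α / q ^ 2 →
      spinSum d R (fun σ => (|mag R σ| / q ^ 3) ^ (2 * j + 4)) ≤ K * spinSum d R fun _ => 1 := by
    intro j
    obtain ⟨K, hK, hpoly⟩ := exists_mul_pow_le (192 * (α + (8 * j + 8))) (by positivity) (2 * j + 2)
    refine ⟨2 * K, by positivity, ?_⟩
    intro V _ _ R d q hq hd hR hd3 hn hwin
    have hq0 : 0 < q := by linarith
    have hmom := moment_inequality hd hR j
    -- in terms of `v = |M| / q ^ 3`, all terms of the moment inequality are of order `q ^ (6 * j + 4)`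
    set v : (V → Bool) → ℝ := fun σ => |mag R σ| / q ^ 3 with hv
    have hv0 : ∀ σ, 0 ≤ v σ := fun σ => by positivity
    have hmv : ∀ σ, |mag R σ| = q ^ 3 * v σ := fun σ => by
      simp only [hv]; field_simp
    have s4 : spinSum d R (fun σ => |mag R σ| ^ (2 * j + 4)) =
        q ^ (6 * j + 12) * spinSum d R fun σ => v σ ^ (2 * j + 4) := by
      rw [← spinSum_mul]
      congr 1; funext σ; rw [hmv, mul_pow, ← pow_mul]; congr 2; ring
    have s2 : spinSum d R (fun σ => |mag R σ| ^ (2 * j + 2)) =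
        q ^ (6 * j + 6) * spinSum d R fun σ => v σ ^ (2 * j + 2) := by
      rw [← spinSum_mul]
      congr 1; funext σ; rw [hmv, mul_pow, ← pow_mul]; congr 2; ring
    have s0 : spinSum d R (fun σ => (|mag R σ| + 1) ^ (2 * j)) ≤
        q ^ (6 * j) * spinSum d R fun σ => (v σ + 1) ^ (2 * j + 2) := by
      rw [← spinSum_mul]
      refine spinSum_mono d R fun σ => ?_
      have h1 : (1 : ℝ) ≤ q ^ 3 := one_le_pow₀ hq
      calc (|mag R σ| + 1) ^ (2 * j) ≤ (q ^ 3 * (v σ + 1)) ^ (2 * j) := by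
            rw [hmv]
            have := hv0 σ
            gcongr
            nlinarith
        _ = q ^ (6 * j) * (v σ + 1) ^ (2 * j) := by
            rw [mul_pow, ← pow_mul]; congr 2; ring
        _ ≤ q ^ (6 * j) * (v σ + 1) ^ (2 * j + 2) := by
            gcongr
            · have := hv0 σ; linarith
            · omega
    have s2' : spinSum d R (fun σ => v σ ^ (2 * j + 2)) ≤
        spinSum d R fun σ => (v σ + 1) ^ (2 * j + 2) :=
      spinSum_mono d R fun σ => by
        have := hv0 σ
        gcongr
        linarith
    have hpos : ∀ F : (V → Bool) → ℝ, (∀ σ, 0 ≤ F σ) → 0 ≤ spinSum d R F := fun F hF =>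
      Finset.sum_nonneg fun σ _ => mul_nonneg (hF σ) (Real.exp_pos _).le
    set E4 := spinSum d R fun σ => v σ ^ (2 * j + 4)
    set E2 := spinSum d R fun σ => v σ ^ (2 * j + 2)
    set E1 := spinSum d R fun σ => (v σ + 1) ^ (2 * j + 2)
    have hE4 : 0 ≤ E4 := hpos _ fun σ => pow_nonneg (hv0 σ) _
    have hE2 : 0 ≤ E2 := hpos _ fun σ => pow_nonneg (hv0 σ) _
    have hE1 : 0 ≤ E1 := hpos _ fun σ => pow_nonneg (by have := hv0 σ; linarith) _
    rw [s4, s2] at hmom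
    have b1 : q ^ (6 * j + 4) / 192 * E4 ≤ R.card * (d ^ 3 / 12) * (q ^ (6 * j + 12) * E4) := by
      have : q ^ (6 * j + 4) / 192 * E4 =
          1 / (16 * q ^ 8) * (1 / 12) * (q ^ (6 * j + 12) * E4) := by
        have : q ^ (6 * j + 12) = q ^ (6 * j + 4) * q ^ 8 := by ring
        rw [this]; field_simp; ring
      rw [this]
      have h12 : (R.card : ℝ) * (d ^ 3 / 12) = R.card * d ^ 3 * (1 / 12) := by ring
      rw [h12]
      gcongr
    have b2 : (R.card * d - 1) * (q ^ (6 * j + 6) * E2) ≤ α * q ^ (6 * j + 4) * E1 := by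
      calc (R.card * d - 1) * (q ^ (6 * j + 6) * E2)
          ≤ α / q ^ 2 * (q ^ (6 * j + 6) * E2) := by gcongr
        _ = α * q ^ (6 * j + 4) * E2 := by
            have : q ^ (6 * j + 6) = q ^ (6 * j + 4) * q ^ 2 := by ring
            rw [this]; field_simp
        _ ≤ _ := by gcongr
    have b3 : R.card * (8 * j + 8) * spinSum d R (fun σ => (|mag R σ| + 1) ^ (2 * j)) ≤
        (8 * j + 8) * q ^ (6 * j + 4) * E1 := by
      have h0 : 0 ≤ spinSum d R fun σ => (|mag R σ| + 1) ^ (2 * j) :=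
        hpos _ fun σ => by positivity
      calc _ ≤ q ^ 4 * (8 * j + 8) * (q ^ (6 * j) * E1) := by gcongr
        _ = _ := by ring
    have b4 : q ^ (6 * j + 4) * E4 ≤ q ^ (6 * j + 4) * (192 * (α + (8 * j + 8)) * E1) := by
      nlinarith
    have b5 : E4 ≤ 192 * (α + (8 * j + 8)) * E1 :=
      le_of_mul_le_mul_left b4 (by positivity)
    have b6 : 192 * (α + (8 * j + 8)) * E1 ≤ E4 / 2 + K * spinSum d R fun _ => 1 := by
      have e : E4 / 2 = 1 / 2 * E4 := by ring
      rw [e, ← spinSum_mul, ← spinSum_mul, ← spinSum_mul, ← spinSum_add]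
      refine spinSum_mono d R fun σ => ?_
      have := hpoly (v σ) (hv0 σ)
      rw [mul_one]
      calc _ ≤ _ := this
        _ = _ := by ring
    linarith
  have conv : ∀ (V : Type u) [Fintype V] [DecidableEq V] (R : Finset V) (d q : ℝ), 1 ≤ q →
      ∀ k : ℕ, spinSum d R (fun σ => |mag R σ| ^ (2 * k)) =
        q ^ (6 * k) * spinSum d R (fun σ => (|mag R σ| / q ^ 3) ^ (2 * k)) := by
    intro V _ _ R d q hq k
    have hq0 : q ≠ 0 := by linarith
    rw [← spinSum_mul]
    congr 1; funext σ
    rw [div_pow, ← pow_mul, show 3 * (2 * k) = 6 * k by ring]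
    field_simp
  match k with
  | 0 => exact ⟨1, zero_le_one, fun V _ _ R d q _ _ _ _ _ _ => by simp⟩
  | 1 =>
    obtain ⟨K, hK, h⟩ := main 0
    refine ⟨1 + K, by positivity, ?_⟩
    intro V _ _ R d q hq hd hR hd3 hn hwin
    rw [conv V R d q hq, mul_comm (1 + K), mul_assoc]
    refine mul_le_mul_of_nonneg_left ?_ (by positivity)
    have h1 := h V R d q hq hd hR hd3 hn hwin
    have h2 : spinSum d R (fun σ => (|mag R σ| / q ^ 3) ^ (2 * 1)) ≤
        spinSum d R (fun _ => 1) + spinSum d R (fun σ => (|mag R σ| / q ^ 3) ^ (2 * 0 + 4)) := by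
      rw [← spinSum_add]
      refine spinSum_mono d R fun σ => ?_
      nlinarith [sq_nonneg ((|mag R σ| / q ^ 3) ^ 2 - 1)]
    linarith
  | j + 2 =>
    obtain ⟨K, hK, h⟩ := main j
    refine ⟨K, hK, ?_⟩
    intro V _ _ R d q hq hd hR hd3 hn hwin
    rw [conv V R d q hq, mul_comm K, mul_assoc]
    exact mul_le_mul_of_nonneg_left (h V R d q hq hd hR hd3 hn hwin) (by positivity)

/-! ### Current masses in the critical window -/

section Correlations

variable {V : Type*} [DecidableEq V]

theorem exists_prod_spin_eq {m : ℕ} (f : Fin m → V) :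
    ∃ S : Finset V, ∀ σ : V → Bool, ∏ i, spin (σ (f i)) = ∏ x ∈ S, spin (σ x) := by
  induction m with
  | zero => exact ⟨∅, fun σ => by simp⟩
  | succ m ih =>
    obtain ⟨S, hS⟩ := ih fun i => f i.succ
    by_cases h : f 0 ∈ S
    · refine ⟨S.erase (f 0), fun σ => ?_⟩
      rw [Fin.prod_univ_succ, hS, ← Finset.mul_prod_erase S _ h, ← mul_assoc, spin_mul_self, one_mul]
    · refine ⟨insert (f 0) S, fun σ => ?_⟩
      rw [Fin.prod_univ_succ, hS, Finset.prod_insert h]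

variable [Fintype V]

/-- The first Griffiths inequality: it holds since the correlations count currents. -/
theorem spinSum_prod_nonneg {d : ℝ} (hd : 0 ≤ d) (R S : Finset V) :
    0 ≤ spinSum d R fun σ => ∏ x ∈ S, spin (σ x) := by
  have h := spinCurrentMass_nonneg hd R S
  unfold spinCurrentMass at h
  exact nonneg_of_mul_nonneg_right h (by positivity)

theorem spinSum_univ_perm (d : ℝ) (e : Equiv.Perm V) (F : (V → Bool) → ℝ) :
    spinSum d (Finset.univ : Finset V) (fun σ => F (σ ∘ e)) = spinSum d Finset.univ F := by
  unfold spinSum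
  rw [← Equiv.sum_comp (Equiv.arrowCongr e.symm (Equiv.refl Bool))
    fun σ => F σ * Real.exp (d * mag Finset.univ σ ^ 2 / 2)]
  refine Finset.sum_congr rfl fun σ _ => ?_
  have h1 : (Equiv.arrowCongr e.symm (Equiv.refl Bool)) σ = σ ∘ e := by
    funext x; simp
  have h2 : mag (Finset.univ : Finset V) (σ ∘ e) = mag Finset.univ σ :=
    Equiv.sum_comp e fun x => spin (σ x)
  rw [h1, h2]

/-- The correlation of `m` distinct sites is at most the `m`-th moment of the magnetization divided
by the number of ways to choose the sites. -/
theorem descFactorial_mul_spinSum_le {d : ℝ} (hd : 0 ≤ d) (S : Finset V) :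
    ((Fintype.card V).descFactorial S.card : ℝ) *
      spinSum d Finset.univ (fun σ => ∏ x ∈ S, spin (σ x)) ≤
      spinSum d Finset.univ fun σ : V → Bool => mag Finset.univ σ ^ S.card := by
  classical
  set m := S.card with hm
  let f₀ : Fin m ↪ V := (S.equivFin.symm.toEmbedding).trans (Function.Embedding.subtype _)
  have hf₀ : ∀ σ : V → Bool, ∏ x ∈ S, spin (σ x) = ∏ i, spin (σ (f₀ i)) := by
    intro σ
    rw [← Finset.prod_coe_sort S fun x => spin (σ x)]
    exact (Equiv.prod_comp S.equivFin.symm fun x : S => spin (σ x)).symm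
  have hall : ∀ f : Fin m ↪ V, spinSum d Finset.univ (fun σ => ∏ i, spin (σ (f i))) =
      spinSum d Finset.univ fun σ => ∏ x ∈ S, spin (σ x) := by
    intro f
    have := Equiv.Perm.isMultiplyPretransitive V m
    obtain ⟨e, he⟩ := MulAction.exists_smul_eq (Equiv.Perm V) f₀ f
    rw [← spinSum_univ_perm d e fun σ => ∏ x ∈ S, spin (σ x)]
    congr 1
    funext σ
    rw [hf₀]
    refine Finset.prod_congr rfl fun i _ => ?_
    rw [← he]
    rfl
  have hpow : ∀ σ : V → Bool, mag Finset.univ σ ^ m = ∑ f : Fin m → V, ∏ i, spin (σ (f i)) :=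
    fun σ => Fintype.sum_pow _ _
  simp only [hpow]
  rw [spinSum_sum]
  calc ((Fintype.card V).descFactorial m : ℝ) *
      spinSum d Finset.univ (fun σ => ∏ x ∈ S, spin (σ x))
      = ∑ f : Fin m ↪ V, spinSum d Finset.univ (fun σ => ∏ i, spin (σ (f i))) := by
        rw [Finset.sum_congr rfl fun f _ => hall f, Finset.sum_const, nsmul_eq_mul,
          Finset.card_univ, Fintype.card_embedding_eq, Fintype.card_fin]
    _ = ∑ f ∈ Finset.image (fun f : Fin m ↪ V => (⇑f : Fin m → V)) Finset.univ,
          spinSum d Finset.univ (fun σ => ∏ i, spin (σ (f i))) := by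
        rw [Finset.sum_image fun f _ g _ h => DFunLike.coe_injective h]
    _ ≤ ∑ f : Fin m → V, spinSum d Finset.univ (fun σ => ∏ i, spin (σ (f i))) := by
        refine Finset.sum_le_sum_of_subset_of_nonneg (Finset.subset_univ _) fun f _ _ => ?_
        obtain ⟨S', hS'⟩ := exists_prod_spin_eq f
        simp only [hS']
        exact spinSum_prod_nonneg hd _ _

theorem cosh_le_one_add {y : ℝ} (hy : |y| ≤ 2) : Real.cosh y ≤ 1 + 4 * y ^ 2 := by
  have h1 := Real.cosh_le_exp_half_sq y
  have hy2 : y ^ 2 ≤ 4 := by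
    have := sq_le_sq' (by linarith [abs_nonneg y]) hy
    rw [sq_abs] at this
    linarith
  have h2 : Real.exp (y ^ 2 / 2) ≤ Real.exp 2 := Real.exp_le_exp.2 (by linarith)
  have h3 : Real.exp 2 ≤ 8 := by
    have h2 : Real.exp 2 = Real.exp 1 ^ 2 := by rw [← Real.exp_nat_mul]; norm_num
    have h5 : Real.exp 1 ^ 2 ≤ (2.7182818286 : ℝ) ^ 2 := by
      have h3 := Real.exp_one_lt_d9
      gcongr
    rw [h2]
    norm_num at h5
    linarith
  have h4 : Real.exp (y ^ 2 / 2) * (1 - y ^ 2 / 2) ≤ 1 := by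
    have := Real.add_one_le_exp (-(y ^ 2 / 2))
    calc _ ≤ Real.exp (y ^ 2 / 2) * Real.exp (-(y ^ 2 / 2)) := by
          gcongr; linarith
      _ = 1 := by rw [← Real.exp_add]; simp
  nlinarith [sq_nonneg y]

/-- Adding a site multiplies the mass of the sourceless currents by the mean of
`cosh (d * M)`. -/
theorem spinCurrentMass_insert_le {d : ℝ} (hd : 0 ≤ d) {R : Finset V} (hR : d * R.card ≤ 2)
    {x : V} (hx : x ∉ R) {B : ℝ}
    (hB : spinSum d R (fun σ => |mag R σ| ^ 2) ≤ B * spinSum d R fun _ => 1) :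
    spinCurrentMass d (insert x R) ∅ ≤ (1 + 4 * d ^ 2 * B) * spinCurrentMass d R ∅ := by
  have h1 : spinSum d (insert x R) (fun _ => 1) =
      Real.exp (d / 2) * spinSum d R fun σ => Real.cosh (d * mag R σ) := by
    unfold spinSum
    rw [sum_flip x, Finset.mul_sum, Finset.sum_div]
    refine Finset.sum_congr rfl fun σ _ => ?_
    have hins : ∀ σ : V → Bool, mag (insert x R) σ = spin (σ x) + mag R σ := fun σ =>
      Finset.sum_insert hx
    beta_reduce
    rw [hins, hins, mag_update hx, Function.update_self, spin_not, Real.cosh_eq]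
    set s := mag R σ
    have e1 : ∀ ε : ℝ, ε * ε = 1 → Real.exp (d * (ε + s) ^ 2 / 2) =
        Real.exp (d / 2) * Real.exp (d * s ^ 2 / 2) * Real.exp (ε * (d * s)) := by
      intro ε hε
      rw [← Real.exp_add, ← Real.exp_add]
      congr 1
      linear_combination (d / 2) * hε
    rw [e1 (spin (σ x)) (spin_mul_self _), e1 (-spin (σ x)) (by rw [neg_mul_neg, spin_mul_self])]
    cases σ x <;> simp only [spin, if_true, Bool.false_eq_true, if_false, one_mul, neg_mul, neg_neg]
      <;> ring
  have h2 : spinSum d R (fun σ => Real.cosh (d * mag R σ)) ≤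
      (1 + 4 * d ^ 2 * B) * spinSum d R fun _ => 1 := by
    calc spinSum d R (fun σ => Real.cosh (d * mag R σ))
        ≤ spinSum d R (fun σ => 1 + 4 * d ^ 2 * |mag R σ| ^ 2) := by
          refine spinSum_mono d R fun σ => ?_
          have habs : |d * mag R σ| ≤ 2 := by
            rw [abs_mul, abs_of_nonneg hd]
            exact le_trans (mul_le_mul_of_nonneg_left (abs_mag_le R σ) hd) hR
          refine (cosh_le_one_add habs).trans (le_of_eq ?_)
          rw [sq_abs]; ring
      _ = spinSum d R (fun _ => 1) + 4 * d ^ 2 * spinSum d R (fun σ => |mag R σ| ^ 2) := by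
          rw [spinSum_add, spinSum_mul]
      _ ≤ spinSum d R (fun _ => 1) + 4 * d ^ 2 * (B * spinSum d R fun _ => 1) := by gcongr
      _ = _ := by ring
  unfold spinCurrentMass
  simp only [Finset.prod_empty]
  rw [h1, Finset.card_insert_of_notMem hx]
  have h3 : Real.exp (-(d * ((R.card + 1 : ℕ) : ℝ) / 2)) * Real.exp (d / 2) =
      Real.exp (-(d * R.card / 2)) := by
    rw [← Real.exp_add]
    congr 1
    push_cast
    ring
  calc _ = ((2 : ℝ) ^ Fintype.card V)⁻¹ * (Real.exp (-(d * ((R.card + 1 : ℕ) : ℝ) / 2)) *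
        Real.exp (d / 2)) * spinSum d R (fun σ => Real.cosh (d * mag R σ)) := by ring
    _ ≤ ((2 : ℝ) ^ Fintype.card V)⁻¹ * Real.exp (-(d * R.card / 2)) *
        ((1 + 4 * d ^ 2 * B) * spinSum d R fun _ => 1) := by rw [h3]; gcongr
    _ = _ := by ring

end Correlations

/-- The coupling `d` lies in the critical window of the Curie-Weiss model on `n` sites:
`d = (1 + O(1 / √n)) / n`. The parameter `q` is `n ^ (1 / 4)`, so that `√n = q ^ 2` and the
magnetization is of order `q ^ 3`. -/
structure CriticalWindow (α d q : ℝ) (n : ℕ) : Prop where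
  one_le : 1 ≤ q
  card_eq : q ^ 4 = n
  le_coupling : 1 / (2 * q ^ 4) ≤ d
  coupling_le : d * (n + 1) ≤ 2
  window : n * d - 1 ≤ α / q ^ 2
  window_low : 1 - α / q ^ 2 ≤ n * d

theorem CriticalWindow.pos {α d q : ℝ} {n : ℕ} (h : CriticalWindow α d q n) : 0 < d := by
  have := h.one_le
  exact lt_of_lt_of_le (by positivity) h.le_coupling

theorem CriticalWindow.exists_moment_le (α : ℝ) (hα : 0 ≤ α) (k : ℕ) :
    ∃ K : ℝ, 0 ≤ K ∧ ∀ (V : Type u) [Fintype V] [DecidableEq V] (R : Finset V) (d q : ℝ),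
      CriticalWindow α d q (Fintype.card V) → Fintype.card V ≤ 2 * R.card →
      spinSum d R (fun σ => |mag R σ| ^ (2 * k)) ≤ K * q ^ (6 * k) * spinSum d R fun _ => 1 := by
  obtain ⟨K, hK, h⟩ := Tangled.exists_moment_le.{u} α hα k
  refine ⟨K, hK, fun V _ _ R d q hw hR => ?_⟩
  have hd := hw.pos
  have hq := hw.one_le
  have hq0 : 0 < q := by linarith
  have hcard : (R.card : ℝ) ≤ Fintype.card V := by exact_mod_cast Finset.card_le_univ R
  have hR' : (Fintype.card V : ℝ) ≤ 2 * R.card := by exact_mod_cast hR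
  rw [← hw.card_eq] at hR'
  refine h V R d q hq hd ?_ ?_ (hcard.trans hw.card_eq.ge) ?_
  · exact le_trans (by gcongr) hw.coupling_le
  · have h3 : (1 / (2 * q ^ 4)) ^ 3 ≤ d ^ 3 := by
      have := hw.le_coupling
      gcongr
    calc 1 / (16 * q ^ 8) = (q ^ 4 / 2) * (1 / (2 * q ^ 4)) ^ 3 := by field_simp; norm_num
      _ ≤ R.card * d ^ 3 := by gcongr; linarith
  · have := hw.window
    have : R.card * d ≤ Fintype.card V * d := by gcongr
    linarith

/-- In the critical window, `2 * k` sources cost a factor of order `n ^ (- k / 2)`. -/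
theorem exists_spinCurrentMass_le (α : ℝ) (hα : 0 ≤ α) (k : ℕ) :
    ∃ K : ℝ, 0 < K ∧ ∀ (V : Type u) [Fintype V] [DecidableEq V] (S : Finset V) (d q : ℝ),
      CriticalWindow α d q (Fintype.card V) → S.card = 2 * k → 4 * k ≤ Fintype.card V →
      spinCurrentMass d Finset.univ S ≤ K / q ^ (2 * k) * spinCurrentMass d (Finset.univ : Finset V) ∅ := by
  obtain ⟨K, hK, h⟩ := CriticalWindow.exists_moment_le.{u} α hα k
  refine ⟨K * 4 ^ k + 1, by positivity, fun V _ _ S d q hw hS hk => ?_⟩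
  have hd := hw.pos
  have hq := hw.one_le
  have hq0 : 0 < q := by linarith
  have h1 := h V Finset.univ d q hw (by rw [Finset.card_univ]; omega)
  have h2 := descFactorial_mul_spinSum_le hd.le S
  rw [hS] at h2
  simp only [pow_mul, sq_abs] at h1 h2
  have h3 := h2.trans h1
  have h4 : (q ^ 4 / 2) ^ (2 * k) ≤ ((Fintype.card V).descFactorial (2 * k) : ℝ) := by
    have h5 := Nat.pow_sub_le_descFactorial (Fintype.card V) (2 * k)
    have h6 : (((Fintype.card V + 1 - 2 * k : ℕ) : ℝ)) ^ (2 * k) ≤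
        ((Fintype.card V).descFactorial (2 * k) : ℝ) := by exact_mod_cast h5
    refine le_trans ?_ h6
    gcongr
    rw [hw.card_eq, Nat.cast_sub (by omega)]
    have : (4 * k : ℝ) ≤ Fintype.card V := by exact_mod_cast hk
    push_cast
    linarith
  have hC := spinSum_prod_nonneg hd.le Finset.univ S
  set C := spinSum d Finset.univ fun σ : V → Bool => ∏ x ∈ S, spin (σ x)
  set Z := spinSum d Finset.univ fun _ : V → Bool => (1 : ℝ) with hZdef
  have hZ : 0 ≤ Z := Finset.sum_nonneg fun σ _ => by positivity
  have h7 : (q ^ 4 / 2) ^ (2 * k) * C ≤ K * (q ^ 6) ^ k * Z :=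
    le_trans (by gcongr) h3
  have h8 : C ≤ K * 4 ^ k / q ^ (2 * k) * Z := by
    have e1 : (q ^ 4 / 2) ^ (2 * k) = (q ^ 6) ^ k * (q ^ (2 * k) / 4 ^ k) := by
      rw [pow_mul, pow_mul q 2 k, ← div_pow, ← mul_pow]
      congr 1
      ring
    rw [e1, mul_assoc, mul_comm K, mul_assoc] at h7
    have h9 := le_of_mul_le_mul_left h7 (by positivity)
    have h10 : C = (4 ^ k / q ^ (2 * k)) * (q ^ (2 * k) / 4 ^ k * C) := by field_simp
    rw [h10]
    calc _ ≤ (4 ^ k / q ^ (2 * k)) * (K * Z) := by gcongr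
      _ = _ := by ring
  unfold spinCurrentMass
  simp only [Finset.prod_empty]
  rw [← hZdef]
  calc _ ≤ ((2 : ℝ) ^ Fintype.card V)⁻¹ * Real.exp (-(d * (Finset.univ : Finset V).card / 2)) *
        (K * 4 ^ k / q ^ (2 * k) * Z) := by gcongr
    _ ≤ ((2 : ℝ) ^ Fintype.card V)⁻¹ * Real.exp (-(d * (Finset.univ : Finset V).card / 2)) *
        ((K * 4 ^ k + 1) / q ^ (2 * k) * Z) := by gcongr; linarith
    _ = _ := by ring

/-- In the critical window, removing `O(√n)` sites changes the mass of the sourceless currents by a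
bounded factor only. -/
theorem exists_le_spinCurrentMass (α : ℝ) (hα : 0 ≤ α) (L : ℝ) :
    ∃ c : ℝ, 0 < c ∧ ∀ (V : Type u) [Fintype V] [DecidableEq V] (R : Finset V) (d q : ℝ),
      CriticalWindow α d q (Fintype.card V) → Fintype.card V ≤ 2 * R.card →
      (Fintype.card V : ℝ) - R.card ≤ L * q ^ 2 →
      c * spinCurrentMass d (Finset.univ : Finset V) ∅ ≤ spinCurrentMass d R ∅ := by
  obtain ⟨K, hK, h⟩ := CriticalWindow.exists_moment_le.{u} α hα 1
  refine ⟨Real.exp (-(16 * K * L)), Real.exp_pos _, fun V _ _ R d q hw hR hL => ?_⟩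
  have hd := hw.pos
  have hq := hw.one_le
  have hq0 : 0 < q := by linarith
  have hdq : d * q ^ 4 ≤ 2 := by
    rw [hw.card_eq]
    exact le_trans (by gcongr; linarith) hw.coupling_le
  have hstep : ∀ R : Finset V, Fintype.card V ≤ 2 * R.card → ∀ x ∉ R,
      spinCurrentMass d (insert x R) ∅ ≤ Real.exp (16 * K / q ^ 2) * spinCurrentMass d R ∅ := by
    intro R hR x hx
    have hcard : (R.card : ℝ) ≤ Fintype.card V := by exact_mod_cast Finset.card_le_univ R
    have h1 := h V R d q hw hR
    simp only [mul_one] at h1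
    have h2 := spinCurrentMass_insert_le hd.le
      (le_trans (by gcongr; linarith) hw.coupling_le) hx h1
    refine h2.trans ?_
    have h3 : 1 + 4 * d ^ 2 * (K * q ^ 6) ≤ Real.exp (16 * K / q ^ 2) := by
      refine le_trans ?_ (Real.add_one_le_exp _)
      have : 4 * d ^ 2 * (K * q ^ 6) = 4 * K / q ^ 2 * (d * q ^ 4) ^ 2 := by field_simp
      rw [this]
      have : 4 * K / q ^ 2 * (d * q ^ 4) ^ 2 ≤ 4 * K / q ^ 2 * 2 ^ 2 := by gcongr
      have e : 4 * K / q ^ 2 * 2 ^ 2 = 16 * K / q ^ 2 := by ring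
      linarith
    have := (spinCurrentMass_empty_pos d R).le
    gcongr
  have hind : ∀ (j : ℕ) (R : Finset V), Fintype.card V ≤ 2 * R.card →
      Fintype.card V = R.card + j →
      spinCurrentMass d (Finset.univ : Finset V) ∅ ≤
        Real.exp (16 * K / q ^ 2) ^ j * spinCurrentMass d R ∅ := by
    intro j
    induction j with
    | zero =>
      intro R _ hj
      have : R = Finset.univ := (Finset.card_eq_iff_eq_univ R).1 (by omega)
      simp [this]
    | succ j ih =>
      intro R hR hj
      obtain ⟨x, hx⟩ : ∃ x, x ∉ R := by
        by_contra hall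
        push Not at hall
        have : R = Finset.univ := Finset.eq_univ_iff_forall.2 hall
        rw [this, Finset.card_univ] at hj
        omega
      have hc := Finset.card_insert_of_notMem hx
      refine (ih (insert x R) (by omega) (by omega)).trans ?_
      rw [pow_succ _ j, mul_assoc]
      exact mul_le_mul_of_nonneg_left (hstep R hR x hx) (by positivity)
  have hle := Finset.card_le_univ R
  have hfin := hind (Fintype.card V - R.card) R hR (by omega)
  have hpow : Real.exp (16 * K / q ^ 2) ^ (Fintype.card V - R.card) ≤ Real.exp (16 * K * L) := by
    rw [← Real.exp_nat_mul]
    refine Real.exp_le_exp.2 ?_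
    rw [Nat.cast_sub hle]
    calc _ ≤ L * q ^ 2 * (16 * K / q ^ 2) := by gcongr
      _ = _ := by field_simp
  have hpos := (spinCurrentMass_empty_pos d R).le
  calc Real.exp (-(16 * K * L)) * spinCurrentMass d (Finset.univ : Finset V) ∅
      ≤ Real.exp (-(16 * K * L)) * (Real.exp (16 * K * L) * spinCurrentMass d R ∅) := by
        gcongr
        exact hfin.trans (by gcongr)
    _ = spinCurrentMass d R ∅ := by
        rw [← mul_assoc, ← Real.exp_add]; simp

/-! ### The lower bound in the critical window -/

theorem eventually_criticalWindow (g a : ℝ) :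
    ∀ᶠ N : ℕ in atTop, CriticalWindow |a * ((12 / g) ^ (1 / 4 : ℝ)) ^ 2| (coupling g a N)
      (√√(N : ℝ)) N := by
  set α := a * ((12 / g) ^ (1 / 4 : ℝ)) ^ 2 with hα
  have h1 : Tendsto (fun N : ℕ => √(N : ℝ)) atTop atTop :=
    Real.tendsto_sqrt_atTop.comp tendsto_natCast_atTop_atTop
  filter_upwards [h1.eventually_ge_atTop (4 * |α| + 2)] with N hN
  set s := √(N : ℝ) with hs
  have hN0 : (0 : ℝ) ≤ N := Nat.cast_nonneg N
  have hs2 : s ^ 2 = N := Real.sq_sqrt hN0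
  have hα0 := abs_nonneg α
  have hs1 : 2 ≤ s := by linarith
  have hs0 : 0 < s := by linarith
  have hq2 : √s ^ 2 = s := Real.sq_sqrt hs0.le
  have hq4 : √s ^ 4 = N := by
    rw [show √s ^ 4 = (√s ^ 2) ^ 2 by ring, hq2, hs2]
  have hN4 : (4 : ℝ) ≤ N := by nlinarith
  have hNd : (N : ℝ) * coupling g a N = 1 - α / s := by
    unfold coupling
    rw [← hα, ← hs]
    field_simp
  have hd : coupling g a N = (1 - α / s) / N := by
    rw [← hNd]; field_simp
  have hαs : |α / s| ≤ 1 / 4 := by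
    rw [abs_div, abs_of_pos hs0, div_le_iff₀ hs0]
    linarith
  have hαs' : |α / s| = |α| / s := by rw [abs_div, abs_of_pos hs0]
  obtain ⟨l1, l2⟩ := abs_le.1 hαs
  refine ⟨?_, hq4, ?_, ?_, ?_, ?_⟩
  · rw [Real.one_le_sqrt]; linarith
  · rw [hq4, hd, div_le_div_iff₀ (by linarith) (by linarith)]
    nlinarith
  · rw [hd, div_mul_eq_mul_div, div_le_iff₀ (by linarith)]
    nlinarith
  · rw [hNd, hq2, ← hαs']
    linarith [neg_abs_le (α / s)]
  · rw [hNd, hq2, ← hαs']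
    linarith [le_abs_self (α / s)]

theorem exp_le_one_sub {x : ℝ} (h0 : 0 ≤ x) (h1 : x ≤ 1 / 2) : Real.exp (-(2 * x)) ≤ 1 - x := by
  have h2 := Real.add_one_le_exp (2 * x)
  rw [Real.exp_neg, inv_le_comm₀ (Real.exp_pos _) (by linarith)]
  refine le_trans ?_ h2
  rw [inv_le_iff_one_le_mul₀ (by linarith)]
  nlinarith

/-- In the critical window, an event with `2 * k` marked points has mass at least of order
`n ^ (- k / 2)` times the mass of the sourceless configurations. -/
theorem exists_le_mass_event (α : ℝ) (hα : 0 ≤ α) (k : ℕ) :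
    ∃ c : ℝ, 0 < c ∧ ∃ q₀ : ℝ, ∀ (V ι : Type u) [Fintype V] [DecidableEq V] [DecidableEq ι]
      (col : ι → Bool) (P : Setoid ι) (A : Finset ι) (pos : ι → V) (d q : ℝ),
      CriticalWindow α d q (Fintype.card V) → q₀ ≤ q → A.card = 2 * k → EvenClasses col P A →
      Placed Finset.univ A pos →
      ENNReal.ofReal (c / q ^ (2 * k) * spinCurrentMass d (Finset.univ : Finset V) ∅ ^ 2) ≤
        mass d (event col P Finset.univ A pos) := by
  -- the `3 * k` walks visit at most `5 * k * q ^ 2` vertices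
  obtain ⟨c, hc, hmass⟩ := exists_le_spinCurrentMass.{u} α hα (5 * k)
  -- a step of a walk multiplies the mass by at least `1 - C / q ^ 2`, and `q ^ 2` steps by `θ`
  set C : ℝ := α + 14 * k with hC
  have hC0 : 0 ≤ C := by positivity
  set θ : ℝ := Real.exp (-(2 * C)) with hθ
  have hθ0 : 0 < θ := Real.exp_pos _
  have hθ1 : θ ≤ 1 := Real.exp_le_one_iff.2 (by linarith)
  refine ⟨(θ ^ 3 / 4) ^ k * c ^ 2, by positivity, 2 * C + 10 * k + 1, ?_⟩
  intro V ι _ _ _ col P A pos d q hw hq₀ hA hE hpos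
  have hd := hw.pos
  have hk0 : (0 : ℝ) ≤ k := Nat.cast_nonneg k
  have hq1 := hw.one_le
  have hq0 : 0 < q := by linarith
  have hqq : q ≤ q ^ 2 := by nlinarith
  set n := Fintype.card V with hn
  have hn4 := hw.card_eq
  have hdq : d * q ^ 4 ≤ 2 := by
    rw [hw.card_eq]
    exact le_trans (by gcongr; linarith) hw.coupling_le
  set t := ⌊q ^ 2⌋₊ with ht
  have ht1 : (t : ℝ) ≤ q ^ 2 := Nat.floor_le (by positivity)
  have ht2 : q ^ 2 ≤ t + 1 := (Nat.lt_floor_add_one _).le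
  -- the walks use only a small part of the vertices
  have hL : (k * (3 * t + 2) : ℝ) ≤ 5 * k * q ^ 2 := by nlinarith
  have hhalf : 5 * k * q ^ 2 ≤ q ^ 4 / 2 := by nlinarith
  have hrn : k * (3 * t + 2) ≤ n := by
    have : ((k * (3 * t + 2) : ℕ) : ℝ) ≤ n := by
      push_cast
      rw [← hn4]
      have : 0 ≤ q ^ 4 := by positivity
      linarith
    exact_mod_cast this
  set r := n - k * (3 * t + 2) with hr
  have hrcast : (r : ℝ) = n - k * (3 * t + 2) := by
    rw [hr, Nat.cast_sub hrn]; push_cast; ring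
  set b : ℝ := 1 - C / q ^ 2 with hb
  have hCq : C / q ^ 2 ≤ 1 / 2 := by
    rw [div_le_iff₀ (by positivity)]
    linarith
  have hCq0 : 0 ≤ C / q ^ 2 := by positivity
  have hb0 : 0 ≤ b := by linarith
  have hβ : ENNReal.ofReal b ≤ ENNReal.ofReal d * ((r - 2 * k : ℕ) : ℝ≥0∞) := by
    rw [← ENNReal.ofReal_natCast, ← ENNReal.ofReal_mul hd.le]
    refine ENNReal.ofReal_le_ofReal ?_
    have h1 : (r : ℝ) - 2 * k ≤ ((r - 2 * k : ℕ) : ℝ) := by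
      have := Nat.le_sub_iff_add_le (k := 2 * k) (m := r - 2 * k) (n := r)
      have h : r ≤ (r - 2 * k) + 2 * k := by omega
      have : (r : ℝ) ≤ ((r - 2 * k : ℕ) : ℝ) + 2 * k := by exact_mod_cast h
      linarith
    have h2 : (n : ℝ) - 7 * k * q ^ 2 ≤ ((r - 2 * k : ℕ) : ℝ) := by
      have : (1 : ℝ) ≤ q ^ 2 := by nlinarith
      nlinarith
    calc b ≤ n * d - 14 * k / q ^ 2 := by
          have := hw.window_low
          have e : C / q ^ 2 = α / q ^ 2 + 14 * k / q ^ 2 := by rw [hC, add_div]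
          linarith
      _ ≤ d * (n - 7 * k * q ^ 2) := by
          have : d * (7 * k * q ^ 2) ≤ 14 * k / q ^ 2 := by
            rw [le_div_iff₀ (by positivity)]
            nlinarith
          nlinarith
      _ ≤ _ := by gcongr
  have hG : ENNReal.ofReal (q ^ 2 * θ) ≤ ∑ j ∈ Finset.range (t + 1), ENNReal.ofReal b ^ j := by
    have hbt : θ ≤ b ^ t := by
      calc θ ≤ Real.exp (-(2 * (C / q ^ 2))) ^ t := by
            rw [← Real.exp_nat_mul, hθ]
            refine Real.exp_le_exp.2 ?_
            have : t * (C / q ^ 2) ≤ q ^ 2 * (C / q ^ 2) := by gcongr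
            have e : q ^ 2 * (C / q ^ 2) = C := by field_simp
            linarith
        _ ≤ b ^ t := by
            have := exp_le_one_sub hCq0 hCq
            gcongr
    have hterm : ∀ j ∈ Finset.range (t + 1), ENNReal.ofReal θ ≤ ENNReal.ofReal b ^ j := by
      intro j hj
      rw [← ENNReal.ofReal_pow hb0]
      refine ENNReal.ofReal_le_ofReal (hbt.trans ?_)
      exact pow_le_pow_of_le_one hb0 (by linarith) (by simpa [Nat.lt_succ_iff] using hj)
    refine le_trans ?_ (Finset.sum_le_sum hterm)
    rw [Finset.sum_const, Finset.card_range, nsmul_eq_mul, ← ENNReal.ofReal_natCast,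
      ← ENNReal.ofReal_mul (by positivity)]
    refine ENNReal.ofReal_le_ofReal ?_
    push_cast
    gcongr
  have hlow := hw.le_coupling
  set η : ℝ := θ ^ 3 / 4 / q ^ 2 with hη
  have hγ₁ : ENNReal.ofReal η ≤
      ENNReal.ofReal d * ∑ j ∈ Finset.range (t + 1), ENNReal.ofReal b ^ j := by
    refine le_trans ?_ (mul_le_mul_right hG _)
    rw [← ENNReal.ofReal_mul hd.le]
    refine ENNReal.ofReal_le_ofReal ?_
    calc η ≤ θ / 2 / q ^ 2 := by
          rw [hη]
          gcongr ?_ / _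
          have : θ ^ 3 ≤ θ ^ 1 := pow_le_pow_of_le_one hθ0.le hθ1 (by norm_num)
          linarith
      _ = 1 / (2 * q ^ 4) * (q ^ 2 * θ) := by field_simp
      _ ≤ d * (q ^ 2 * θ) := by gcongr
  have hγ₃ : ENNReal.ofReal η ≤
      ENNReal.ofReal d ^ 2 * (∑ j ∈ Finset.range (t + 1), ENNReal.ofReal b ^ j) ^ 3 := by
    refine le_trans ?_ (mul_le_mul_right (pow_le_pow_left' hG 3) _)
    rw [← ENNReal.ofReal_pow hd.le, ← ENNReal.ofReal_pow (by positivity),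
      ← ENNReal.ofReal_mul (by positivity)]
    refine ENNReal.ofReal_le_ofReal ?_
    calc η = (1 / (2 * q ^ 4)) ^ 2 * (q ^ 2 * θ) ^ 3 := by rw [hη]; field_simp; norm_num
      _ ≤ d ^ 2 * (q ^ 2 * θ) ^ 3 := by gcongr
  set z := spinCurrentMass d (Finset.univ : Finset V) ∅ with hz
  have hz0 : 0 < z := spinCurrentMass_empty_pos d _
  have he : ∀ (R : Finset V) (pos : ι → V), r ≤ R.card →
      ENNReal.ofReal ((c * z) ^ 2) ≤ mass d (event col P R ∅ pos) := by
    intro R pos hR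
    have hR' : (r : ℝ) ≤ R.card := by exact_mod_cast hR
    rw [mass_event_empty col P hd.le, ENNReal.ofReal_pow (by positivity)]
    gcongr
    refine hmass V R d q hw ?_ ?_
    · have : (n : ℝ) ≤ 2 * R.card := by linarith
      exact_mod_cast this
    · linarith
  have key := le_mass_event hd.le t hβ hγ₁ hγ₃ he k A hA le_rfl hE Finset.univ pos hpos
    (by rw [Finset.card_univ]; omega)
  refine le_trans (le_of_eq ?_) key
  rw [← ENNReal.ofReal_pow (by positivity), ← ENNReal.ofReal_mul (by positivity)]
  congr 1
  rw [hη, div_pow (θ ^ 3 / 4), ← pow_mul]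
  ring

/-! ### Tangling probabilities -/

section Handshake

variable {V : Type*} [Fintype V] [DecidableEq V]

/-- The handshake lemma in a union `C` of clusters. -/
theorem Current.even_card_sources_inter (n : Current V) (C : Finset V)
    (hC : ∀ x y, 0 < n.val x y → x ∈ C → y ∈ C) : Even (C.filter fun x => x ∈ n.sources).card := by
  have h : Even (∑ x ∈ C, n.degree x) := by
    simp only [Current.degree_eq_sum_edges]
    rw [Finset.sum_comm]
    refine Finset.even_sum _ fun e _ => ?_
    rw [← Finset.sum_filter, Finset.sum_const, smul_eq_mul]
    rcases Nat.eq_zero_or_pos (n e) with h0 | h0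
    · simp [h0]
    · refine Even.mul_right ?_ _
      obtain ⟨e, he⟩ := e
      induction e using Sym2.ind with
      | _ x y =>
        have hxy : x ≠ y := by simpa using he
        have hval : 0 < n.val x y := by rwa [Current.val_of_ne _ hxy]
        have hiff : x ∈ C ↔ y ∈ C :=
          ⟨hC x y hval, hC y x (by rwa [Current.val_comm])⟩
        by_cases hx : x ∈ C
        · have : C.filter (fun v => v ∈ s(x, y)) = {x, y} := by
            ext v
            simp only [Finset.mem_filter, Sym2.mem_iff, Finset.mem_insert, Finset.mem_singleton]
            constructor
            · exact fun h => h.2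
            · rintro (rfl | rfl)
              · exact ⟨hx, Or.inl rfl⟩
              · exact ⟨hiff.1 hx, Or.inr rfl⟩
          change Even (C.filter (fun v => v ∈ s(x, y))).card
          rw [this, Finset.card_pair hxy]
          exact even_two
        · have : C.filter (fun v => v ∈ s(x, y)) = ∅ := by
            ext v
            simp only [Finset.mem_filter, Sym2.mem_iff, Finset.notMem_empty, iff_false, not_and,
              not_or]
            intro hv
            exact ⟨fun h => hx (h ▸ hv), fun h => hx (hiff.2 (h ▸ hv))⟩
          change Even (C.filter (fun v => v ∈ s(x, y))).card
          rw [this]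
          exact Even.zero
  rw [Finset.even_sum_iff_even_card_odd] at h
  simpa [Current.sources] using h

end Handshake

section Tangling

theorem isAdmissible_top {X : Type*} {S T : Finset X} (hS : Even S.card) (hT : Even T.card) :
    IsAdmissible S T ⊤ := by
  rintro c ⟨y, rfl⟩
  have : {x | (⊤ : Setoid X) x y} = Set.univ := Set.eq_univ_of_forall fun x => trivial
  rw [this, Set.univ_inter, Set.univ_inter, Set.ncard_coe_finset, Set.ncard_coe_finset]
  exact ⟨hS, hT⟩

theorem card_blockVertex {X : Type*} [Fintype X] {N : ℕ} (h : Fintype.card X ≤ N) :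
    Fintype.card (BlockVertex X N) = N := by
  rw [Fintype.card_sum, Fintype.card_fin]
  omega

variable {X : Type u} [Fintype X] [DecidableEq X]

theorem isAdmissible_clusterPartition {S T : Finset X} {N : ℕ}
    {p : Current (BlockVertex X N) × Current (BlockVertex X N)} (hp : p ∈ sourcedPairs S T N) :
    IsAdmissible S T (clusterPartition (p.1 + p.2)) := by
  classical
  have main : ∀ (n : Current (BlockVertex X N)) (U : Finset X),
      n.sources = U.map Function.Embedding.inl → (∀ x y, n.val x y ≤ (p.1 + p.2).val x y) →
      ∀ c ∈ (clusterPartition (p.1 + p.2)).classes, Even (c ∩ (U : Set X)).ncard := by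
    rintro n U hU hle c ⟨y, rfl⟩
    have h := n.even_card_sources_inter
      (Finset.univ.filter fun v => (p.1 + p.2).graph.Reachable v (Sum.inl y)) (by
        intro v w hvw hv
        simp only [Finset.mem_filter, Finset.mem_univ, true_and] at hv ⊢
        have hadj : (p.1 + p.2).graph.Adj v w :=
          (Current.graph_adj _ _ _).2 (hvw.trans_le (hle v w))
        exact hadj.reachable.symm.trans hv)
    rw [hU] at h
    have heq : ((Finset.univ.filter fun v => (p.1 + p.2).graph.Reachable v (Sum.inl y)).filter
        fun x => x ∈ U.map Function.Embedding.inl) =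
        (U.filter fun x => (p.1 + p.2).graph.Reachable (Sum.inl x) (Sum.inl y)).map
          Function.Embedding.inl := by
      ext v
      simp only [Finset.mem_filter, Finset.mem_univ, true_and, Finset.mem_map]
      constructor
      · rintro ⟨h1, x, hx, rfl⟩
        exact ⟨x, ⟨hx, h1⟩, rfl⟩
      · rintro ⟨x, ⟨hx, h1⟩, rfl⟩
        exact ⟨h1, x, hx, rfl⟩
    rw [heq, Finset.card_map] at h
    have hset : {x | (clusterPartition (p.1 + p.2)) x y} ∩ (U : Set X) =
        ((U.filter fun x => (p.1 + p.2).graph.Reachable (Sum.inl x) (Sum.inl y) : Finset X) :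
          Set X) := by
      ext x
      simp only [Finset.coe_filter, Set.mem_inter_iff, Set.mem_ofPred_eq, Finset.mem_coe]
      exact and_comm
    rw [hset, Set.ncard_coe_finset]
    exact h
  intro c hc
  exact ⟨main p.1 S hp.1 (fun x y => by rw [Current.val_add]; omega) c hc,
    main p.2 T hp.2 (fun x y => by rw [Current.val_add]; omega) c hc⟩

/-- The masses of pairs of currents, as masses of configurations. -/
theorem pairMass_eq {g a : ℝ} {N : ℕ} (hd : 0 ≤ coupling g a N)
    (E : Set (Current (BlockVertex X N) × Current (BlockVertex X N))) :
    pairMass g a N E =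
      (mass (coupling g a N) {m : Config (BlockVertex X N) | (m false, m true) ∈ E}).toReal := by
  let φ : E ≃ {m : Config (BlockVertex X N) | (m false, m true) ∈ E} :=
    { toFun := fun p => ⟨fun b => bif b then p.1.2 else p.1.1, p.2⟩
      invFun := fun m => ⟨(m.1 false, m.1 true), m.2⟩
      left_inv := fun p => rfl
      right_inv := fun m => by
        apply Subtype.ext
        funext b
        cases b <;> rfl }
  rw [mass, ← φ.tsum_eq, ENNReal.tsum_toReal_eq, pairMass]
  · refine tsum_congr fun p => ?_
    have h1 := Current.weight_nonneg hd p.1.1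
    have h2 := Current.weight_nonneg hd p.1.2
    simp only [Config.weight, φ, Equiv.coe_fn_mk, Fintype.prod_bool, cond_true, cond_false,
      ENNReal.toReal_mul, ENNReal.toReal_ofReal h1, ENNReal.toReal_ofReal h2]
    ring
  · intro p
    exact ENNReal.prod_ne_top fun _ _ => ENNReal.ofReal_ne_top

theorem mass_sourcedPairs {d : ℝ} (hd : 0 ≤ d) (S T : Finset X) (N : ℕ) :
    mass d {m : Config (BlockVertex X N) | (m false, m true) ∈ sourcedPairs S T N} =
      ENNReal.ofReal (spinCurrentMass d (Finset.univ : Finset (BlockVertex X N))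
        (S.map Function.Embedding.inl) *
        spinCurrentMass d (Finset.univ : Finset (BlockVertex X N))
        (T.map Function.Embedding.inl)) := by
  rw [ENNReal.ofReal_mul (spinCurrentMass_nonneg hd _ _), ← tsum_weight hd, ← tsum_weight hd,
    ← mass_prod]
  congr 1
  ext m
  simp [sourcedPairs, Current.SupportedOn]

theorem mass_sourcedPairs_ne_top {d : ℝ} (hd : 0 ≤ d) (S T : Finset X) (N : ℕ) :
    mass d {m : Config (BlockVertex X N) | (m false, m true) ∈ sourcedPairs S T N} ≠ ∞ := by
  rw [mass_sourcedPairs hd]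
  exact ENNReal.ofReal_ne_top

/-- The tangling event is an event described by marked points: the points of the block, coloured
by the layer in which they are sources. -/
theorem event_eq_tangling {S T : Finset X} (hST : Disjoint S T) (hU : S ∪ T = Finset.univ)
    (P : Setoid X) (N : ℕ) :
    event (fun x => decide (x ∈ T)) P Finset.univ Finset.univ
      (Sum.inl : X → BlockVertex X N) =
    {m : Config (BlockVertex X N) |
      (m false, m true) ∈ {p ∈ sourcedPairs S T N | clusterPartition (p.1 + p.2) = P}} := by
  have hmem : ∀ x, x ∈ S ↔ x ∉ T := by
    intro x
    have h1 : x ∈ S ∪ T := by rw [hU]; exact Finset.mem_univ x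
    rw [Finset.mem_union] at h1
    have h2 : ¬ (x ∈ S ∧ x ∈ T) := fun h => Finset.disjoint_left.1 hST h.1 h.2
    tauto
  ext m
  have hsrc : ∀ (n : Current (BlockVertex X N)) (U : Finset X),
      n.sources = U.map Function.Embedding.inl ↔
        ∀ z, Odd (n.degree z) ↔ ∃ u ∈ U, (Sum.inl u : BlockVertex X N) = z := by
    intro n U
    rw [Finset.ext_iff]
    refine forall_congr' fun z => ?_
    simp [Current.sources]
  simp only [event, sourcedPairs, Set.mem_ofPred_eq, Finset.mem_univ, true_and, forall_true_left,
    Bool.forall_bool, decide_eq_false_iff_not, decide_eq_true_eq, hsrc, hmem]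
  have hsupp : m.SupportedOn Finset.univ := fun _ _ _ _ => Finset.mem_univ _
  have hpart : (∀ u w : X, m.total.graph.Reachable (Sum.inl u) (Sum.inl w) ↔ P u w) ↔
      clusterPartition (m false + m true) = P := by
    rw [Setoid.ext_iff]
    rfl
  rw [← hpart]
  tauto

theorem IsAdmissible.evenClasses {S T : Finset X} (hST : Disjoint S T)
    (hU : S ∪ T = Finset.univ) {P : Setoid X} (h : IsAdmissible S T P) :
    EvenClasses (fun x => decide (x ∈ T)) P Finset.univ := by
  classical
  have hmem : ∀ x, x ∈ S ↔ x ∉ T := by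
    intro x
    have h1 : x ∈ S ∪ T := by rw [hU]; exact Finset.mem_univ x
    rw [Finset.mem_union] at h1
    have h2 : ¬ (x ∈ S ∧ x ∈ T) := fun h => Finset.disjoint_left.1 hST h.1 h.2
    tauto
  intro x _ i
  obtain ⟨h1, h2⟩ := h {y | P y x} (P.mem_classes x)
  have key : ∀ U : Finset X, Even ({y | P y x} ∩ (U : Set X)).ncard →
      Even (Finset.univ.filter fun u => P x u ∧ u ∈ U).card := by
    intro U hE
    rw [← Set.ncard_coe_finset]
    convert hE using 2
    ext u
    simp only [Finset.coe_filter, Finset.mem_univ, true_and, Set.mem_ofPred_eq,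
      Set.mem_inter_iff, Finset.mem_coe, P.comm']
  cases i
  · have := key S h1
    simpa [hmem] using this
  · have := key T h2
    simpa using this

theorem tanglingProb_nonneg (g a : ℝ) (S T : Finset X) (N : ℕ) (hd : 0 ≤ coupling g a N)
    (P : Setoid X) : 0 ≤ tanglingProb g a S T N P := by
  rw [tanglingProb, pairMass_eq hd, pairMass_eq hd]
  positivity

/-- For large `N`, the tangling probabilities of the admissible partitions are bounded below. -/
theorem exists_le_tanglingProb (g a : ℝ) (s t : ℕ) :
    ∃ κ : ℝ, 0 < κ ∧ ∀ (X : Type u) [Fintype X] [DecidableEq X] (S T : Finset X),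
      Disjoint S T → S ∪ T = Finset.univ → S.card = 2 * s → T.card = 2 * t →
      ∀ᶠ N : ℕ in atTop, 0 ≤ coupling g a N ∧ 0 < pairMass g a N (sourcedPairs S T N) ∧
        ∀ P : Setoid X, IsAdmissible S T P → κ ≤ tanglingProb g a S T N P := by
  set α := |a * ((12 / g) ^ (1 / 4 : ℝ)) ^ 2| with hα
  have hα0 : 0 ≤ α := abs_nonneg _
  obtain ⟨c, hc, q₀, hlow⟩ := exists_le_mass_event.{u} α hα0 (s + t)
  obtain ⟨K, hK, hS⟩ := exists_spinCurrentMass_le.{u} α hα0 s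
  obtain ⟨K', hK', hT⟩ := exists_spinCurrentMass_le.{u} α hα0 t
  refine ⟨c / (K * K'), by positivity, ?_⟩
  intro X _ _ S T hST hU hs ht
  have hq : Tendsto (fun N : ℕ => √√(N : ℝ)) atTop atTop :=
    Real.tendsto_sqrt_atTop.comp (Real.tendsto_sqrt_atTop.comp tendsto_natCast_atTop_atTop)
  have hcardX : Fintype.card X = 2 * (s + t) := by
    rw [← Finset.card_univ, ← hU, Finset.card_union_of_disjoint hST, hs, ht]; ring
  filter_upwards [eventually_criticalWindow g a, hq.eventually_ge_atTop q₀,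
    eventually_ge_atTop (4 * (s + t))] with N hwin hqN hN
  rw [← hα] at hwin
  have hcard : Fintype.card (BlockVertex X N) = N := card_blockVertex (by omega)
  set d := coupling g a N with hd_def
  set q := √√(N : ℝ) with hq_def
  have hd := hwin.pos
  have hq0 : 0 < q := lt_of_lt_of_le one_pos hwin.one_le
  rw [← hcard] at hwin
  set z := spinCurrentMass d (Finset.univ : Finset (BlockVertex X N)) ∅ with hz
  have hz0 : 0 < z := spinCurrentMass_empty_pos d _
  have bS := hS (BlockVertex X N) (S.map Function.Embedding.inl) d q hwin (by simpa using hs)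
    (by omega)
  have bT := hT (BlockVertex X N) (T.map Function.Embedding.inl) d q hwin (by simpa using ht)
    (by omega)
  have nS := spinCurrentMass_nonneg hd.le (Finset.univ : Finset (BlockVertex X N))
    (S.map Function.Embedding.inl)
  have nT := spinCurrentMass_nonneg hd.le (Finset.univ : Finset (BlockVertex X N))
    (T.map Function.Embedding.inl)
  have htot := mass_sourcedPairs hd.le S T N
  have htop := mass_sourcedPairs_ne_top hd.le S T N
  have hpair : pairMass g a N (sourcedPairs S T N) =
      spinCurrentMass d (Finset.univ : Finset (BlockVertex X N)) (S.map Function.Embedding.inl) *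
      spinCurrentMass d (Finset.univ : Finset (BlockVertex X N)) (T.map Function.Embedding.inl) := by
    rw [pairMass_eq hd.le, htot, ENNReal.toReal_ofReal (by positivity)]
  have hup : pairMass g a N (sourcedPairs S T N) ≤ K * K' / q ^ (2 * (s + t)) * z ^ 2 := by
    rw [hpair]
    calc _ ≤ (K / q ^ (2 * s) * z) * (K' / q ^ (2 * t) * z) := by gcongr
      _ = _ := by rw [mul_add, pow_add]; field_simp
  have hmass : ∀ P : Setoid X, IsAdmissible S T P →
      c / q ^ (2 * (s + t)) * z ^ 2 ≤
        pairMass g a N {p ∈ sourcedPairs S T N | clusterPartition (p.1 + p.2) = P} := by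
    intro P hP
    have h := hlow (BlockVertex X N) X (fun x => decide (x ∈ T)) P Finset.univ Sum.inl d q hwin hqN
      (by rw [Finset.card_univ, hcardX]) (hP.evenClasses hST hU)
      ⟨fun _ _ => Finset.mem_univ _, Sum.inl_injective.injOn⟩
    rw [event_eq_tangling hST hU P N] at h
    rw [pairMass_eq hd.le]
    refine (ENNReal.ofReal_le_iff_le_toReal ?_).1 h
    exact ne_top_of_le_ne_top htop (mass_mono d fun m hm => hm.1)
  have hadm : IsAdmissible S T ⊤ :=
    isAdmissible_top (hs ▸ even_two_mul s) (ht ▸ even_two_mul t)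
  have hpos : 0 < pairMass g a N (sourcedPairs S T N) := by
    refine lt_of_lt_of_le (by positivity) ((hmass ⊤ hadm).trans ?_)
    rw [pairMass_eq hd.le, pairMass_eq hd.le]
    exact ENNReal.toReal_mono htop (mass_mono d fun m hm => hm.1)
  refine ⟨hd.le, hpos, fun P hP => ?_⟩
  rw [tanglingProb, le_div_iff₀ hpos]
  calc c / (K * K') * pairMass g a N (sourcedPairs S T N)
      ≤ c / (K * K') * (K * K' / q ^ (2 * (s + t)) * z ^ 2) := by gcongr
    _ = c / q ^ (2 * (s + t)) * z ^ 2 := by field_simp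
    _ ≤ _ := hmass P hP

/-- The tangling probabilities of the admissible partitions add up to one. -/
theorem sum_tanglingProb (g a : ℝ) (S T : Finset X) (N : ℕ) (hd : 0 ≤ coupling g a N)
    (hpos : 0 < pairMass g a N (sourcedPairs S T N)) [Fintype (AdmissiblePartition S T)] :
    ∑ P : AdmissiblePartition S T, tanglingProb g a S T N P.1 = 1 := by
  set d := coupling g a N with hd_def
  have htop := mass_sourcedPairs_ne_top hd S T N
  let E : AdmissiblePartition S T → Set (Config (BlockVertex X N)) := fun P =>
    {m | (m false, m true) ∈ {p ∈ sourcedPairs S T N | clusterPartition (p.1 + p.2) = P.1}}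
  have hsum : ∑ P, mass d (E P) =
      mass d {m : Config (BlockVertex X N) | (m false, m true) ∈ sourcedPairs S T N} := by
    rw [← sum_mass_fiber d
      {m : Config (BlockVertex X N) | (m false, m true) ∈ sourcedPairs S T N} fun m hm =>
      (⟨clusterPartition (N := N) (m false + m true),
        isAdmissible_clusterPartition (N := N) (p := (m false, m true)) hm⟩ :
        AdmissiblePartition S T)]
    refine Finset.sum_congr rfl fun P _ => ?_
    congr 1
    ext m
    exact ⟨fun h => ⟨h.1, Subtype.ext h.2⟩, fun ⟨h, h'⟩ => ⟨h, congrArg Subtype.val h'⟩⟩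
  have hfin : ∀ P ∈ Finset.univ, mass d (E P) ≠ ∞ := fun P _ =>
    ne_top_of_le_ne_top htop (mass_mono d fun m hm => hm.1)
  simp only [tanglingProb]
  rw [← Finset.sum_div, div_eq_one_iff_eq hpos.ne', pairMass_eq hd, ← hsum,
    ENNReal.toReal_sum hfin]
  exact Finset.sum_congr rfl fun P _ => pairMass_eq hd _

end Tangling

/-! ### Limiting tangling measures -/

section Limits

variable {X : Type u} [Fintype X] [DecidableEq X]

/-- By compactness, the tangling probabilities converge to a probability measure along some
sequence of sizes. -/
theorem exists_isTanglingLimit {g a : ℝ} {S T : Finset X}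
    (h : ∀ᶠ N : ℕ in atTop, 0 ≤ coupling g a N ∧ 0 < pairMass g a N (sourcedPairs S T N)) :
    ∃ (N : ℕ → ℕ) (ρ : PMF (AdmissiblePartition S T)), IsTanglingLimit g a S T N ρ := by
  classical
  have : Finite (Setoid X) := Finite.of_injective (fun P : Setoid X => (P : X → X → Prop))
    fun P Q hPQ => Setoid.ext fun x y => iff_of_eq (congrFun (congrFun hPQ x) y)
  have := Fintype.ofFinite (AdmissiblePartition S T)
  obtain ⟨N₀, hN₀⟩ := eventually_atTop.1 h
  let v : ℕ → AdmissiblePartition S T → ℝ := fun n P => tanglingProb g a S T (N₀ + n) P.1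
  have hv0 : ∀ n P, 0 ≤ v n P := fun n P =>
    tanglingProb_nonneg g a S T _ (hN₀ _ (Nat.le_add_right _ _)).1 _
  have hv1 : ∀ n, ∑ P, v n P = 1 := fun n =>
    sum_tanglingProb g a S T _ (hN₀ _ (Nat.le_add_right _ _)).1 (hN₀ _ (Nat.le_add_right _ _)).2
  have hmem : ∀ n, v n ∈ Set.Icc (0 : AdmissiblePartition S T → ℝ) 1 := fun n =>
    ⟨fun P => hv0 n P, fun P => by
      rw [Pi.one_apply, ← hv1 n]
      exact Finset.single_le_sum (fun Q _ => hv0 n Q) (Finset.mem_univ P)⟩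
  obtain ⟨l, hl, φ, hφ, hlim⟩ := isCompact_Icc.tendsto_subseq hmem
  have hlimP : ∀ P, Tendsto (fun n => v (φ n) P) atTop (𝓝 (l P)) := fun P =>
    (tendsto_pi_nhds.1 hlim) P
  have hsum : ∑ P, l P = 1 := by
    refine tendsto_nhds_unique (tendsto_finsetSum Finset.univ fun P _ => hlimP P) ?_
    simp only [hv1]
    exact tendsto_const_nhds
  refine ⟨fun n => N₀ + φ n, PMF.ofFintype (fun P => ENNReal.ofReal (l P)) ?_, ?_, ?_⟩
  · rw [← ENNReal.ofReal_sum_of_nonneg fun P _ => hl.1 P, hsum, ENNReal.ofReal_one]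
  · exact fun i j hij => Nat.add_lt_add_left (hφ hij) _
  · intro P
    rw [PMF.ofFintype_apply, ENNReal.toReal_ofReal (hl.1 P)]
    exact hlimP P

theorem IsTanglingLimit.le {g a κ : ℝ} {S T : Finset X} {N : ℕ → ℕ}
    {ρ : PMF (AdmissiblePartition S T)} (hρ : IsTanglingLimit g a S T N ρ)
    (h : ∀ᶠ N : ℕ in atTop, ∀ P : Setoid X, IsAdmissible S T P → κ ≤ tanglingProb g a S T N P)
    (P : AdmissiblePartition S T) : ENNReal.ofReal κ ≤ ρ P := by
  rw [ENNReal.ofReal_le_iff_le_toReal (PMF.apply_ne_top ρ P)]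
  exact ge_of_tendsto (hρ.2 P)
    ((hρ.1.tendsto_atTop.eventually h).mono fun k hk => hk P.1 P.2)

/-- The conclusions of the theorem, for all blocks with a bounded number of points. -/
theorem exists_tangling_bound (g a : ℝ) (B : ℕ) :
    ∃ κ : ℝ, 0 < κ ∧ ∀ (X : Type u) [Fintype X] [DecidableEq X] (S T : Finset X),
      Disjoint S T → S ∪ T = Finset.univ → Even S.card → Even T.card → S.card ≤ B → T.card ≤ B →
      (∃ (N : ℕ → ℕ) (ρ : PMF (AdmissiblePartition S T)), IsTanglingLimit g a S T N ρ) ∧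
      ∀ (N : ℕ → ℕ) (ρ : PMF (AdmissiblePartition S T)), IsTanglingLimit g a S T N ρ →
        (∀ P, ENNReal.ofReal κ ≤ ρ P) ∧
        ENNReal.ofReal κ ≤ ρ.toOuterMeasure {P | P.1 = ⊤} := by
  choose f hf hbound using fun p : ℕ × ℕ => exists_le_tanglingProb.{u} g a p.1 p.2
  obtain ⟨p₀, -, hmin⟩ := Finset.exists_min_image
    (Finset.range (B + 1) ×ˢ Finset.range (B + 1)) f ⟨(0, 0), by simp⟩
  refine ⟨f p₀, hf p₀, ?_⟩
  intro X _ _ S T hST hU hS hT hSB hTB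
  obtain ⟨s, hs⟩ := hS.exists_two_nsmul
  obtain ⟨t, ht⟩ := hT.exists_two_nsmul
  rw [smul_eq_mul] at hs ht
  have hev := hbound (s, t) X S T hST hU hs ht
  have hκ : f p₀ ≤ f (s, t) := hmin (s, t) (by
    simp only [Finset.mem_product, Finset.mem_range]; omega)
  refine ⟨exists_isTanglingLimit (hev.mono fun N h => ⟨h.1, h.2.1⟩), fun N ρ hρ => ?_⟩
  have hle : ∀ P, ENNReal.ofReal (f p₀) ≤ ρ P :=
    hρ.le (hev.mono fun N h P hP => hκ.trans (h.2.2 P hP))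
  refine ⟨hle, (hle ⟨⊤, isAdmissible_top hS hT⟩).trans ?_⟩
  rw [← PMF.toOuterMeasure_apply_singleton]
  exact MeasureTheory.measure_mono (by simp)

end Limits

section Blocks

variable {Λ : Type u} [Fintype Λ] [DecidableEq Λ]

theorem card_block (n : Current (Option Λ)) (A : Option Λ → ℕ) (z : Λ) :
    Fintype.card (Block n A z) = n.degree (some z) + A (some z) := by
  simp [Block, Current.degree]

theorem SameSources.even_card_block {n : Current (Option Λ)} {A : Option Λ → ℕ}
    (h : SameSources n A) (z : Λ) : Even (Fintype.card (Block n A z)) := by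
  rw [card_block, Nat.even_add, ← Nat.not_odd_iff_even, ← Nat.not_odd_iff_even, h z]

end Blocks

end Tangled

theorem proposition4p1 (g a : ℝ) (hg : 0 < g) (M : ℕ) (hM : 1 ≤ M) :
    ∃ κ : ℝ, 0 < κ ∧
      (∀ (Λ : Type u) [Fintype Λ] [DecidableEq Λ]
        (A B : Option Λ → ℕ) (n₁ n₂ : Tangled.Current (Option Λ)),
        Tangled.IsMoment A → Tangled.IsMoment B →
        Tangled.SameSources n₁ A → Tangled.SameSources n₂ B →
        ∀ z : Λ, A (some z) ≤ M → B (some z) ≤ M →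
          Tangled.Current.degree (n₁ + n₂) (some z) ≤ M →
          (∃ (N : ℕ → ℕ) (ρ : PMF (Tangled.DoubleTangling n₁ n₂ A B z)),
            Tangled.IsDoubleTanglingMeasure g a n₁ n₂ A B z N ρ) ∧
          ∀ (N : ℕ → ℕ) (ρ : PMF (Tangled.DoubleTangling n₁ n₂ A B z)),
            Tangled.IsDoubleTanglingMeasure g a n₁ n₂ A B z N ρ →
            (∀ P, ENNReal.ofReal κ ≤ ρ P) ∧
            ENNReal.ofReal κ ≤ ρ.toOuterMeasure {P | P.1 = ⊤}) ∧
      (∀ (Λ : Type u) [Fintype Λ] [DecidableEq Λ]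
        (A : Option Λ → ℕ) (n : Tangled.Current (Option Λ)),
        Tangled.IsMoment A → Tangled.SameSources n A →
        ∀ z : Λ, A (some z) ≤ M → n.degree (some z) ≤ M →
          (∃ (N : ℕ → ℕ) (ρ : PMF (Tangled.SingleTangling n A z)),
            Tangled.IsSingleTanglingMeasure g a n A z N ρ) ∧
          ∀ (N : ℕ → ℕ) (ρ : PMF (Tangled.SingleTangling n A z)),
            Tangled.IsSingleTanglingMeasure g a n A z N ρ →
            (∀ P, ENNReal.ofReal κ ≤ ρ P) ∧
            ENNReal.ofReal κ ≤ ρ.toOuterMeasure {P | P.1 = ⊤}) := by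
  obtain ⟨κ, hκ, h⟩ := Tangled.exists_tangling_bound.{u} g a (2 * M)
  refine ⟨κ, hκ, ?_, ?_⟩
  · intro Λ _ _ A B n₁ n₂ _ _ hA hB z hAM hBM hdeg
    rw [Tangled.Current.degree_add] at hdeg
    refine h (Tangled.DoubleBlock n₁ n₂ A B z) (Tangled.firstPart n₁ n₂ A B z)
      (Tangled.secondPart n₁ n₂ A B z) ?_ ?_ ?_ ?_ ?_ ?_
    · rw [Finset.disjoint_left]
      rintro x hx hx'
      simp only [Tangled.firstPart, Tangled.secondPart, Finset.mem_map, Finset.mem_univ,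
        true_and] at hx hx'
      obtain ⟨y, rfl⟩ := hx
      obtain ⟨y', h'⟩ := hx'
      exact Sum.inr_ne_inl h'
    · ext x
      rcases x with x | x <;> simp [Tangled.firstPart, Tangled.secondPart]
    · rw [Tangled.firstPart, Finset.card_map, Finset.card_univ]
      exact hA.even_card_block z
    · rw [Tangled.secondPart, Finset.card_map, Finset.card_univ]
      exact hB.even_card_block z
    · rw [Tangled.firstPart, Finset.card_map, Finset.card_univ, Tangled.card_block]
      omega
    · rw [Tangled.secondPart, Finset.card_map, Finset.card_univ, Tangled.card_block]
      omega
  · intro Λ _ _ A n _ hA z hAM hdeg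
    refine h (Tangled.Block n A z) Finset.univ ∅ (by simp) (by simp) ?_ (by simp) ?_ (by simp)
    · rw [Finset.card_univ]
      exact hA.even_card_block z
    · rw [Finset.card_univ, Tangled.card_block]
      omega
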